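/- Let $T:\mathcal M_d(\mathbb C)\to\mathcal M_d(\mathbb C)$ be a trace-preserving Schwarz map, i.e. a positive, trace-preserving linear map such that $T^*(A^\dagger A)\ge T^*(A^\dagger)\,T^*(A)$ for all $A\in\mathcal M_d(\mathbb C)$, where the dual $T^*$ is defined by $\operatorname{tr}(T^*(A)B)=\operatorname{tr}(A\,T(B))$ for all $A,B$. Let $$\mathcal X_T:=\operatorname{span}_{\mathbb C}\{X\in\mathcal M_d(\mathbb C)\mid \exists\,\varphi\in\mathbb R:\ T(X)=e^{i\varphi}X\}.$$ 1. There is an orthogonal decomposition $\mathbb C^d=\mathcal H_0\oplus\bigoplus_{k=1}^K\mathcal H_k$ with $\mathcal H_k=\mathcal H_{k,1}\otimes\mathcal H_{k,2}$ (where $\mathcal H_0=0$ is allowed, and $\mathcal H_{k,1}$, $\mathcal H_{k,2}$ are non-zero and may be one-dimensional), and there are positive definite density matrices $\rho_k$ (of trace one) on $\mathcal H_{k,2}$, such that $$\mathcal X_T=0\oplus\bigoplus_{k=1}^K\mathcal M_{d_k}\otimes\rho_k,\qquad d_k:=\dim\mathcal H_{k,1},$$ where $\mathcal M_{d_k}$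 is the full matrix algebra on $\mathcal H_{k,1}$. That is, $\mathcal X_T$ consists exactly of the matrices $X=0\oplus\bigoplus_k x_k\otimes\rho_k$ with $x_k\in\mathcal B(\mathcal H_{k,1})$. 2. There are unitaries $U_k\in\mathcal B(\mathcal H_{k,1})$ and a permutation $\pi$ of $\{1,\dots,K\}$ with $d_{\pi(k)}=d_k$ for all $k$ such that, for every $X=0\oplus\bigoplus_k x_k\otimes\rho_k\in\mathcal X_T$, $$T(X)=0\oplus\bigoplus_{k=1}^K U_k\,x_{\pi(k)}\,U_k^\dagger\otimes\rho_k,$$ where spaces $\mathcal H_{k,1}$ of equal dimension are identified through fixed orthonormal bases. -/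

import Mathlib

open scoped Matrix Kronecker ComplexOrder

/-- The dual `T*` of a linear map `T` on `M_d(ℂ)`, determined by `tr (T*(A) B) = tr (A T(B))`
(see `trace_dualMap_mul`). -/
def dualMap {d : ℕ} (T : Matrix (Fin d) (Fin d) ℂ →ₗ[ℂ] Matrix (Fin d) (Fin d) ℂ) :
    Matrix (Fin d) (Fin d) ℂ →ₗ[ℂ] Matrix (Fin d) (Fin d) ℂ where
  toFun A := Matrix.of fun i j => (A * T (Matrix.single j i 1)).trace
  map_add' A B := by
    ext i j
    simp [Matrix.add_mul]
  map_smul' c A := by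
    ext i j
    simp

/-- The defining property of the dual map. -/
theorem trace_dualMap_mul {d : ℕ} (T : Matrix (Fin d) (Fin d) ℂ →ₗ[ℂ] Matrix (Fin d) (Fin d) ℂ)
    (A B : Matrix (Fin d) (Fin d) ℂ) :
    (dualMap T A * B).trace = (A * T B).trace := by
  have hB : T B = ∑ i, ∑ j, B i j • T (Matrix.single i j 1) := by
    conv_lhs => rw [Matrix.matrix_eq_sum_single B]
    simp only [map_sum]
    refine Finset.sum_congr rfl fun i _ => Finset.sum_congr rfl fun j _ => ?_
    rw [← map_smul, Matrix.smul_single, smul_eq_mul, mul_one]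
  rw [hB]
  simp only [Finset.mul_sum, Matrix.trace_sum, Matrix.mul_smul, Matrix.trace_smul, smul_eq_mul]
  rw [Finset.sum_comm]
  conv_lhs => rw [Matrix.trace]
  simp only [Matrix.diag_apply, Matrix.mul_apply (M := dualMap T A)]
  refine Finset.sum_congr rfl fun i _ => Finset.sum_congr rfl fun j _ => ?_
  simp [dualMap, mul_comm]

/-- A trace-preserving Schwarz map on `M_d(ℂ)`: a positive, trace-preserving linear map `T` whose
dual satisfies the Schwarz inequality `T*(A† A) ≥ T*(A†) T*(A)`. -/
structure IsSchwarzMap {d : ℕ} (T : Matrix (Fin d) (Fin d) ℂ →ₗ[ℂ] Matrix (Fin d) (Fin d) ℂ) :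
    Prop where
  positive : ∀ A : Matrix (Fin d) (Fin d) ℂ, A.PosSemidef → (T A).PosSemidef
  trace_preserving : ∀ A : Matrix (Fin d) (Fin d) ℂ, (T A).trace = A.trace
  schwarz : ∀ A : Matrix (Fin d) (Fin d) ℂ,
    (dualMap T (Aᴴ * A) - dualMap T Aᴴ * dualMap T A).PosSemidef

/-- The complex linear span `X_T` of all eigenvectors of `T` whose eigenvalue is a phase. -/
def peripheralSpace {d : ℕ} (T : Matrix (Fin d) (Fin d) ℂ →ₗ[ℂ] Matrix (Fin d) (Fin d) ℂ) :
    Submodule ℂ (Matrix (Fin d) (Fin d) ℂ) :=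
  Submodule.span ℂ {X | ∃ φ : ℝ, T X = Complex.exp (Complex.I * φ) • X}

/-- Index set of the basis of `H₀ ⊕ ⨁ₖ H_{k,1} ⊗ H_{k,2}`, where `H₀` has dimension `r`,
`H_{k,1}` has dimension `n k` and `H_{k,2}` has dimension `m k`. -/
abbrev BlockIndex {K : ℕ} (r : ℕ) (n m : Fin K → ℕ) : Type :=
  Fin r ⊕ (k : Fin K) × (Fin (n k) × Fin (m k))

/-- The matrix `0 ⊕ ⨁ₖ xₖ ⊗ ρₖ` on `H₀ ⊕ ⨁ₖ H_{k,1} ⊗ H_{k,2}`. -/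
def blockTensor {K : ℕ} (r : ℕ) {n m : Fin K → ℕ}
    (x : (k : Fin K) → Matrix (Fin (n k)) (Fin (n k)) ℂ)
    (ρ : (k : Fin K) → Matrix (Fin (m k)) (Fin (m k)) ℂ) :
    Matrix (BlockIndex r n m) (BlockIndex r n m) ℂ :=
  Matrix.fromBlocks 0 0 0 (Matrix.blockDiagonal' fun k => x k ⊗ₖ ρ k)

/-! Write `E` for the dual `T*`. Suppose first that `T` fixes a positive definite `σ`. If `E A = μ
A` with `|μ| = 1`, then the Schwarz defect `E(A†A) - E(A†)E(A)` is positive and has trace zero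
against `σ`, hence vanishes. Perturbing the Schwarz inequality around such an `A` gives `E(BA) =
E(B)E(A)` for every `B`. The peripheral space `Y` of `E` is therefore a unital self-adjoint algebra
on which `E` is a star automorphism, and in a suitable orthonormal frame `Y = ⨁ M_{n k} ⊗ 1`.

By duality `T(E(A) Z) = A T(Z)` and `T(Z E(A)) = T(Z) A` for `A ∈ Y`. Hence `X_T` is a `Y`-bimodule,
and comparing eigenspace dimensions gives `X_T = Y τ` for every invertible `τ ∈ X_T`. Cutting `σ`
with matrix units of `Y` produces such a `τ` of the form `⨁ 1 ⊗ ρ_k`, so `X_T = ⨁ M_{n k} ⊗ ρ_k`. On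
it `T` acts as the inverse `α` of `E` on `Y`, up to a central factor `z` that trace preservation
forces to be `1`. Finally `α` permutes the summands up to unitary conjugation.

In general `σ` is a limit of Cesàro means of `T^l(1)`. It dominates `Z†Z` up to a constant for each
peripheral eigenvector `Z`, so all of `X_T` lives on the support of `σ`. The corner of that support
is invariant under `T`, the compression of `T` to it is again Schwarz with a positive definite fixed
point, and `H₀` is the kernel of `σ`. The carrying lemmas are `exists_dominating_fixedPoint`,
`map_mul_of_map_conjTranspose_mul_self`, `exists_eq_mul_fixedPoint`, `exists_isBlockSystem` and
`exists_perm_unitary_of_starAlgEquiv`. -/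

/-! ### Spectral and minimal projections in self-adjoint matrix algebras. -/

section Projections

set_option linter.unusedSectionVars false

variable {ι : Type*} [Fintype ι] [DecidableEq ι]

open scoped MatrixOrder in
theorem exists_eq_conjTranspose_mul_self {A : Matrix ι ι ℂ} (hA : A.PosSemidef) :
    ∃ C : Matrix ι ι ℂ, A = Cᴴ * C := by
  classical
  obtain ⟨C, hC⟩ := CStarAlgebra.nonneg_iff_eq_star_mul_self.mp
    (Matrix.nonneg_iff_posSemidef.mpr hA)
  exact ⟨C, hC⟩

theorem eq_zero_of_conjTranspose_mul_self_eq_zero {A : Matrix ι ι ℂ} (h : Aᴴ * A = 0) : A = 0 :=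
  Matrix.conjTranspose_mul_self_eq_zero.mp h

/-- The spectral theorem, in the form `h = U diag(lam) U†`. -/
theorem exists_unitary_diagonal {h : Matrix ι ι ℂ} (hh : h.IsHermitian) :
    ∃ (U : Matrix ι ι ℂ) (lam : ι → ℝ), Uᴴ * U = 1 ∧ U * Uᴴ = 1 ∧
      h = U * Matrix.diagonal (fun i => (lam i : ℂ)) * Uᴴ := by
  refine ⟨hh.eigenvectorUnitary, hh.eigenvalues, ?_, ?_, ?_⟩
  · exact Unitary.coe_star_mul_self hh.eigenvectorUnitary
  · exact Unitary.coe_mul_star_self hh.eigenvectorUnitary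
  · have := hh.spectral_theorem
    rw [Unitary.conjStarAlgAut_apply] at this
    exact this

/-- A linear subspace closed under products contains a nonzero spectral projection of each of its
nonzero hermitian elements. -/
theorem exists_spectral_projection (Y : Submodule ℂ (Matrix ι ι ℂ))
    (hmul : ∀ a ∈ Y, ∀ b ∈ Y, a * b ∈ Y)
    {h : Matrix ι ι ℂ} (hY : h ∈ Y) (hh : h.IsHermitian) (h0 : h ≠ 0) :
    ∃ e ∈ Y, ∃ c : ℂ, e ≠ 0 ∧ eᴴ = e ∧ e * e = e ∧ c ≠ 0 ∧ h * e = c • e := by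
  obtain ⟨U, lam, hU, hU', rfl⟩ := exists_unitary_diagonal hh
  have hne : ∃ i₀, lam i₀ ≠ 0 := by
    by_contra! hc
    exact h0 (by simp [hc])
  obtain ⟨i₀, hi₀⟩ := hne
  have hprod : ∀ f g : ι → ℂ, U * Matrix.diagonal f * Uᴴ * (U * Matrix.diagonal g * Uᴴ)
      = U * Matrix.diagonal (fun i => f i * g i) * Uᴴ := by
    intro f g
    have : U * Matrix.diagonal f * Uᴴ * (U * Matrix.diagonal g * Uᴴ)
      = U * Matrix.diagonal f * (Uᴴ * U) * Matrix.diagonal g * Uᴴ := by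
        simp only [Matrix.mul_assoc]
    rw [this, hU, Matrix.mul_one, Matrix.mul_assoc U, Matrix.diagonal_mul_diagonal]
  have hsmul : ∀ (c : ℂ) (f : ι → ℂ), U * Matrix.diagonal (fun i => c * f i) * Uᴴ
      = c • (U * Matrix.diagonal f * Uᴴ) := by
    intro c f
    rw [← Matrix.smul_mul, ← Matrix.mul_smul, ← Matrix.diagonal_smul]
    rfl
  have hsub : ∀ f g : ι → ℂ, U * Matrix.diagonal (fun i => f i - g i) * Uᴴ
      = U * Matrix.diagonal f * Uᴴ - U * Matrix.diagonal g * Uᴴ := by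
    intro f g
    rw [← Matrix.sub_mul, ← Matrix.mul_sub, Matrix.diagonal_sub]
  have hinj : ∀ f : ι → ℂ, U * Matrix.diagonal f * Uᴴ = 0 → f = 0 := by
    intro f hf
    have h2 : Uᴴ * (U * Matrix.diagonal f * Uᴴ) * U = Matrix.diagonal f := by
      have : Uᴴ * (U * Matrix.diagonal f * Uᴴ) * U
        = (Uᴴ * U) * Matrix.diagonal f * (Uᴴ * U) := by simp only [Matrix.mul_assoc]
      rw [this, hU, Matrix.one_mul, Matrix.mul_one]
    rw [hf] at h2
    simpa using h2.symm
  -- Lagrange interpolation at the eigenvalue `lam i₀`. The polynomial starts from `x / lam i₀`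
  -- instead of a constant because `Y` need not contain `1`; each further factor `(x - μ) / (lam i₀
  -- - μ)` keeps the constant term zero.
  have key : ∀ s : Finset ℝ, ∃ φ : ℝ → ℂ, φ (lam i₀) = 1 ∧
      (∀ μ ∈ s, μ ≠ lam i₀ → φ μ = 0) ∧
      U * Matrix.diagonal (fun i => φ (lam i)) * Uᴴ ∈ Y := by
    intro s
    induction s using Finset.induction_on with
    | empty =>
      refine ⟨fun x => (lam i₀ : ℂ)⁻¹ * x, ?_, by simp, ?_⟩
      · exact inv_mul_cancel₀ (by exact_mod_cast hi₀)
      · rw [hsmul]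
        exact Y.smul_mem _ hY
    | insert μ s hμ ih =>
      obtain ⟨φ, h1, h2, h3⟩ := ih
      by_cases hμ0 : μ = lam i₀
      · refine ⟨φ, h1, ?_, h3⟩
        intro ν hν hν0
        rcases Finset.mem_insert.mp hν with rfl | hν
        · exact absurd hμ0 hν0
        · exact h2 ν hν hν0
      · have hd : ((lam i₀ : ℂ) - μ) ≠ 0 := by
          rw [sub_ne_zero]
          exact_mod_cast (Ne.symm hμ0)
        refine ⟨fun x => ((lam i₀ : ℂ) - μ)⁻¹ * (φ x * x - μ * φ x), ?_, ?_, ?_⟩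
        · simp only [h1]
          field_simp
        · intro ν hν hν0
          rcases Finset.mem_insert.mp hν with rfl | hν
          · ring
          · simp [h2 ν hν hν0]
        · have : U * Matrix.diagonal
              (fun i => ((lam i₀ : ℂ) - μ)⁻¹ * (φ (lam i) * lam i - μ * φ (lam i))) * Uᴴ
            = ((lam i₀ : ℂ) - μ)⁻¹ • (U * Matrix.diagonal (fun i => φ (lam i)) * Uᴴ *
              (U * Matrix.diagonal (fun i => (lam i : ℂ)) * Uᴴ)
              - (μ : ℂ) • (U * Matrix.diagonal (fun i => φ (lam i)) * Uᴴ)) := by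
            rw [hprod, hsmul, hsub, hsmul]
          rw [this]
          exact Y.smul_mem _ (Y.sub_mem (hmul _ h3 _ hY) (Y.smul_mem _ h3))
  obtain ⟨φ, h1, h2, h3⟩ := key (Finset.univ.image lam)
  have hφ : ∀ i, φ (lam i) = if lam i = lam i₀ then 1 else 0 := by
    intro i
    split_ifs with hi
    · rw [hi, h1]
    · exact h2 _ (by simp) hi
  refine ⟨_, h3, lam i₀, ?_, ?_, ?_, by exact_mod_cast hi₀, ?_⟩
  · intro h
    have := congrFun (hinj _ h) i₀
    simp [h1] at this
  · rw [Matrix.conjTranspose_mul, Matrix.conjTranspose_mul, Matrix.conjTranspose_conjTranspose,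
      Matrix.diagonal_conjTranspose, Matrix.mul_assoc]
    congr 3
    ext i
    simp only [Pi.star_apply, hφ]
    split_ifs <;> simp
  · rw [hprod]
    congr 3
    ext i
    simp only [hφ]
    split_ifs <;> simp
  · rw [hprod, ← Matrix.smul_mul, ← Matrix.mul_smul, ← Matrix.diagonal_smul]
    congr 3
    ext i
    simp only [hφ, Pi.smul_apply]
    split_ifs with hi <;> simp [hi]

/-- A nonzero projection `p ∈ Y` of least rank works. A spectral projection `e ∈ Y` of a nonzero
hermitian `h = p h` has range inside that of `p`, so `e = p` by minimality and `h` is a multiple of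
`p`. The general case follows by splitting `p y p` into hermitian and antihermitian parts. -/
theorem exists_minimal_projection (Y : Submodule ℂ (Matrix ι ι ℂ))
    (hmul : ∀ a ∈ Y, ∀ b ∈ Y, a * b ∈ Y) (hstar : ∀ a ∈ Y, aᴴ ∈ Y) (hY : Y ≠ ⊥) :
    ∃ p ∈ Y, p ≠ 0 ∧ pᴴ = p ∧ p * p = p ∧ ∀ y ∈ Y, ∃ c : ℂ, p * y * p = c • p := by
  classical
  have hex : ∃ N : ℕ, ∃ p ∈ Y, p ≠ 0 ∧ pᴴ = p ∧ p * p = p ∧ p.rank = N := by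
    obtain ⟨y, hy, hy0⟩ := Submodule.exists_mem_ne_zero_of_ne_bot hY
    obtain ⟨e, he, c, h1, h2, h3, -⟩ := exists_spectral_projection Y hmul
      (hmul _ (hstar _ hy) _ hy) (Matrix.isHermitian_conjTranspose_mul_self y)
      (fun h => hy0 (eq_zero_of_conjTranspose_mul_self_eq_zero h))
    exact ⟨_, e, he, h1, h2, h3, rfl⟩
  obtain ⟨p, hp, hp0, hps, hpp, hpr⟩ := Nat.find_spec hex
  have hmin : ∀ e ∈ Y, e ≠ 0 → eᴴ = e → e * e = e → p.rank ≤ e.rank := by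
    intro e he h0 h1 h2
    rw [hpr]
    exact Nat.find_min' hex ⟨e, he, h0, h1, h2, rfl⟩
  have hherm : ∀ h ∈ Y, hᴴ = h → p * h = h → ∃ c : ℂ, h = c • p := by
    intro h hh hs hph
    by_cases h0 : h = 0
    · exact ⟨0, by simp [h0]⟩
    obtain ⟨e, he, c, he0, hes, hee, hc, hhe⟩ := exists_spectral_projection Y hmul hh hs h0
    have hpe : p * e = e := by
      have h1 : c • (p * e) = c • e := by
        rw [← Matrix.mul_smul, ← hhe, ← Matrix.mul_assoc, hph]
      have := congrArg (fun x => c⁻¹ • x) h1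
      simpa [smul_smul, inv_mul_cancel₀ hc] using this
    have hsub : LinearMap.range e.mulVecLin ≤ LinearMap.range p.mulVecLin := by
      rintro _ ⟨v, rfl⟩
      exact ⟨e *ᵥ v, by simp [hpe]⟩
    have heq := Submodule.eq_of_le_of_finrank_le hsub (hmin e he he0 hes hee)
    have hep : e * p = p := by
      apply Matrix.toLin'.injective
      refine LinearMap.ext fun v => ?_
      have : p *ᵥ v ∈ LinearMap.range e.mulVecLin := by
        rw [heq]
        exact ⟨v, rfl⟩
      obtain ⟨w, hw⟩ := this
      simp only [Matrix.mulVecLin_apply] at hw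
      simp only [Matrix.toLin'_apply]
      rw [← Matrix.mulVec_mulVec, ← hw, Matrix.mulVec_mulVec, hee]
    have hpe' : e = p := by
      have := congrArg Matrix.conjTranspose hpe
      rw [Matrix.conjTranspose_mul, hes, hps, hep] at this
      exact this.symm
    subst hpe'
    refine ⟨c, ?_⟩
    have := congrArg Matrix.conjTranspose hph
    rw [Matrix.conjTranspose_mul, hs, hes] at this
    rw [← hhe, this]
  refine ⟨p, hp, hp0, hps, hpp, fun y hy => ?_⟩
  have hz : p * y * p ∈ Y := hmul _ (hmul _ hp _ hy) _ hp
  have hzs : (p * y * p)ᴴ ∈ Y := hstar _ hz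
  have hpz : p * (p * y * p) = p * y * p := by
    rw [← Matrix.mul_assoc, ← Matrix.mul_assoc, hpp]
  have hpzs : p * (p * y * p)ᴴ = (p * y * p)ᴴ := by
    simp only [Matrix.conjTranspose_mul, hps, ← Matrix.mul_assoc, hpp]
  obtain ⟨a, ha⟩ := hherm (p * y * p + (p * y * p)ᴴ) (Y.add_mem hz hzs)
    (by simp [add_comm]) (by rw [Matrix.mul_add, hpz, hpzs])
  obtain ⟨b, hb⟩ := hherm (Complex.I • (p * y * p - (p * y * p)ᴴ))
    (Y.smul_mem _ (Y.sub_mem hz hzs))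
    (by rw [Matrix.conjTranspose_smul, Matrix.conjTranspose_sub, Matrix.conjTranspose_conjTranspose,
          Complex.star_def, Complex.conj_I, neg_smul, ← smul_neg, neg_sub])
    (by rw [Matrix.mul_smul, Matrix.mul_sub, hpz, hpzs])
  refine ⟨(1 / 2 : ℂ) * (a - Complex.I * b), ?_⟩
  have hb' : p * y * p - (p * y * p)ᴴ = (-Complex.I * b) • p := by
    rw [mul_smul, ← hb, smul_smul]
    simp
  have : p * y * p = (1 / 2 : ℂ) • ((p * y * p + (p * y * p)ᴴ) + (p * y * p - (p * y * p)ᴴ)) := by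
    rw [add_add_sub_cancel, ← two_smul ℂ, smul_smul]
    norm_num
  rw [this, ha, hb', ← add_smul, smul_smul]
  ring_nf

end Projections

/-! ### Self-adjoint matrix algebras as sums of full matrix algebras. -/

section BlockSystems

set_option linter.unusedSectionVars false

variable {ι : Type*} [Fintype ι] [DecidableEq ι]

/-- The left ideal `Y p` carries the scalar product `c` given by `a† b = c p`, by minimality of `p`.
Evaluation at a unit vector `x` in the range of `p` embeds it isometrically into `ℂ^ι`, and the `v
i` come from an orthonormal basis of the image. Left multiplication by `Y` preserves `Y p`, which
gives the last clause. -/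
theorem exists_column_basis (Y : Submodule ℂ (Matrix ι ι ℂ))
    (hmul : ∀ a ∈ Y, ∀ b ∈ Y, a * b ∈ Y) (hstar : ∀ a ∈ Y, aᴴ ∈ Y)
    {p : Matrix ι ι ℂ} (hpY : p ∈ Y) (hp0 : p ≠ 0) (hps : pᴴ = p) (hpp : p * p = p)
    (hmin : ∀ y ∈ Y, ∃ c : ℂ, p * y * p = c • p) :
    ∃ (N : ℕ) (v : Fin N → Matrix ι ι ℂ), 0 < N ∧ (∀ i, v i ∈ Y) ∧ (∀ i, v i * p = v i) ∧
      (∀ i j, (v i)ᴴ * v j = if i = j then p else 0) ∧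
      ∀ y ∈ Y, ∀ i, ∃ c : Fin N → ℂ, y * v i = ∑ j, c j • v j := by
  obtain ⟨x', hx'⟩ : ∃ x' : ι → ℂ, p *ᵥ x' ≠ 0 := by
    by_contra! hc
    apply hp0
    apply Matrix.toLin'.injective
    exact LinearMap.ext fun v => by simpa using hc v
  set u : EuclideanSpace ℂ ι := WithLp.toLp 2 (p *ᵥ x') with hu
  have hu0 : u ≠ 0 := by
    intro h
    exact hx' (by simpa [hu] using h)
  set x : EuclideanSpace ℂ ι := ((‖u‖⁻¹ : ℝ) : ℂ) • u with hx
  have hxn : ‖x‖ = 1 := by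
    rw [hx, norm_smul]
    simp [hu0]
  have hxin : inner ℂ x x = (1 : ℂ) := by
    rw [inner_self_eq_norm_sq_to_K, hxn]; simp
  have hpx : p *ᵥ x.ofLp = x.ofLp := by
    rw [hx, WithLp.ofLp_smul, Matrix.mulVec_smul, hu]
    simp [hpp]
  let F : Matrix ι ι ℂ →ₗ[ℂ] EuclideanSpace ℂ ι :=
    { toFun := fun a => WithLp.toLp 2 (a *ᵥ x.ofLp)
      map_add' := fun a b => by simp [Matrix.add_mulVec]
      map_smul' := fun c a => by simp [Matrix.smul_mulVec] }
  have hF : ∀ a, F a = WithLp.toLp 2 (a *ᵥ x.ofLp) := fun a => rfl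
  let Z : Submodule ℂ (Matrix ι ι ℂ) :=
    { carrier := {a | a ∈ Y ∧ a * p = a}
      add_mem' := fun ha hb => ⟨Y.add_mem ha.1 hb.1, by rw [Matrix.add_mul, ha.2, hb.2]⟩
      zero_mem' := ⟨Y.zero_mem, by simp⟩
      smul_mem' := fun c a ha => ⟨Y.smul_mem c ha.1, by rw [Matrix.smul_mul, ha.2]⟩ }
  have hin : ∀ a ∈ Z, ∀ b ∈ Z, aᴴ * b = (inner ℂ (F a) (F b) : ℂ) • p := by
    intro a ha b hb
    obtain ⟨c, hc⟩ := hmin (aᴴ * b) (hmul _ (hstar _ ha.1) _ hb.1)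
    have h1 : p * (aᴴ * b) * p = aᴴ * b := by
      have : p * aᴴ = aᴴ := by
        have := congrArg Matrix.conjTranspose ha.2
        rwa [Matrix.conjTranspose_mul, hps] at this
      rw [← Matrix.mul_assoc, this, Matrix.mul_assoc, hb.2]
    rw [h1] at hc
    have h2 : (inner ℂ (F a) (F b) : ℂ) = c := by
      rw [EuclideanSpace.inner_eq_star_dotProduct, hF, hF, dotProduct_comm,
        Matrix.star_mulVec, ← Matrix.dotProduct_mulVec, Matrix.mulVec_mulVec, hc,
        Matrix.smul_mulVec, hpx, dotProduct_smul, dotProduct_comm,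
        ← EuclideanSpace.inner_eq_star_dotProduct, hxin]
      simp
    rw [h2, hc]
  have hinj : ∀ a ∈ Z, F a = 0 → a = 0 := by
    intro a ha h
    apply eq_zero_of_conjTranspose_mul_self_eq_zero
    rw [hin a ha a ha, h]
    simp
  let S := Z.map F
  let b := stdOrthonormalBasis ℂ S
  have hv : ∀ i, ∃ a ∈ Z, F a = b i := fun i => (b i).2
  choose v hvZ hvb using hv
  refine ⟨Module.finrank ℂ S, v, ?_, fun i => (hvZ i).1, fun i => (hvZ i).2, ?_, ?_⟩
  · rw [Module.finrank_pos_iff_exists_ne_zero]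
    have hpZ : p ∈ Z := ⟨hpY, hpp⟩
    refine ⟨⟨F p, p, hpZ, rfl⟩, ?_⟩
    intro h
    exact hp0 (hinj p hpZ (congrArg Subtype.val h))
  · intro i j
    rw [hin _ (hvZ i) _ (hvZ j), hvb, hvb]
    have := orthonormal_iff_ite.mp b.orthonormal i j
    rw [Submodule.coe_inner] at this
    rw [this]
    split_ifs <;> simp
  · intro y hy i
    have hyv : y * v i ∈ Z := ⟨hmul _ hy _ (hvZ i).1, by rw [Matrix.mul_assoc, (hvZ i).2]⟩
    have hs : F (y * v i) ∈ S := ⟨_, hyv, rfl⟩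
    refine ⟨fun j => b.repr ⟨_, hs⟩ j, ?_⟩
    have h1 := b.sum_repr ⟨_, hs⟩
    have h2 := congrArg Subtype.val h1
    simp only [AddSubmonoidClass.coe_finsetSum, SetLike.val_smul] at h2
    have hsum : ∑ j, b.repr ⟨_, hs⟩ j • v j ∈ Z :=
      Z.sum_mem fun j _ => Z.smul_mem _ (hvZ j)
    rw [← sub_eq_zero]
    apply hinj _ (Z.sub_mem hyv hsum)
    rw [map_sub, map_sum, sub_eq_zero]
    refine h2.symm.trans ?_
    simp [hvb]

/-- A system of column vectors `v k i` exhibiting `Y` as a direct sum of full matrix algebras with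
matrix units `v k i * (v k j)ᴴ`. -/
structure IsBlockSystem (Y : Submodule ℂ (Matrix ι ι ℂ)) {κ : Type} [Fintype κ] (n : κ → ℕ)
    (p : κ → Matrix ι ι ℂ) (v : (k : κ) → Fin (n k) → Matrix ι ι ℂ) : Prop where
  pos : ∀ k, 0 < n k
  p_ne_zero : ∀ k, p k ≠ 0
  p_star : ∀ k, (p k)ᴴ = p k
  p_mul_self : ∀ k, p k * p k = p k
  mem : ∀ k i, v k i ∈ Y
  mul_p : ∀ k i, v k i * p k = v k i
  star_mul_same : ∀ k i j, (v k i)ᴴ * v k j = if i = j then p k else 0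
  star_mul_of_ne : ∀ k l, k ≠ l → ∀ i j, (v k i)ᴴ * v l j = 0
  span : ∀ y ∈ Y, ∃ x : (k : κ) → Matrix (Fin (n k)) (Fin (n k)) ℂ,
    y = ∑ k, ∑ i, ∑ j, x k i j • (v k i * (v k j)ᴴ)

/-- Induction on the dimension. A minimal projection with its column basis `w` yields one full
matrix block, whose unit `z = ∑ w i (w i)†` is a central projection of `Y`; the ideal `{a ∈ Y | a z
= 0}` is strictly smaller and supplies the other blocks. -/
theorem exists_isBlockSystem_aux (N : ℕ) : ∀ Y : Submodule ℂ (Matrix ι ι ℂ),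
    Module.finrank ℂ Y ≤ N → (∀ a ∈ Y, ∀ b ∈ Y, a * b ∈ Y) → (∀ a ∈ Y, aᴴ ∈ Y) →
    ∃ (κ : Type) (_ : Fintype κ) (n : κ → ℕ)
    (p : κ → Matrix ι ι ℂ) (v : (k : κ) → Fin (n k) → Matrix ι ι ℂ), IsBlockSystem Y n p v := by
  induction N with
  | zero =>
    intro Y hN _ _
    have hY : Y = ⊥ := Submodule.finrank_eq_zero.mp (Nat.le_zero.mp hN)
    refine ⟨Empty, inferInstance, Empty.elim, Empty.elim, fun k => k.elim, ?_⟩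
    constructor <;> try exact fun k => k.elim
    intro y hy
    refine ⟨fun k => k.elim, ?_⟩
    simpa [hY] using hy
  | succ N ih =>
    intro Y hN hmul hstar
    by_cases hY : Y = ⊥
    · exact ih Y (by subst hY; simp) hmul hstar
    obtain ⟨p, hp, hp0, hps, hpp, hmin⟩ := exists_minimal_projection Y hmul hstar hY
    obtain ⟨m, w, hm, hwY, hwp, hww, hspan⟩ :=
      exists_column_basis Y hmul hstar hp hp0 hps hpp hmin
    set z := ∑ i, w i * (w i)ᴴ with hz
    have hzY : z ∈ Y := Y.sum_mem fun i _ => hmul _ (hwY i) _ (hstar _ (hwY i))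
    have hzs : zᴴ = z := by simp [hz, Matrix.conjTranspose_sum]
    have hpw : ∀ i, p * (w i)ᴴ = (w i)ᴴ := by
      intro i
      have := congrArg Matrix.conjTranspose (hwp i)
      rwa [Matrix.conjTranspose_mul, hps] at this
    have hzw : ∀ i, z * w i = w i := by
      intro i
      rw [hz, Matrix.sum_mul, Finset.sum_eq_single i]
      · rw [Matrix.mul_assoc, hww, if_pos rfl, hwp]
      · intro j _ hj
        rw [Matrix.mul_assoc, hww, if_neg hj, Matrix.mul_zero]
      · simp
    have hwz : ∀ i, (w i)ᴴ * z = (w i)ᴴ := by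
      intro i
      have := congrArg Matrix.conjTranspose (hzw i)
      rwa [Matrix.conjTranspose_mul, hzs] at this
    have hyz : ∀ y ∈ Y, ∃ x : Matrix (Fin m) (Fin m) ℂ,
        y * z = ∑ i, ∑ j, x i j • (w i * (w j)ᴴ) := by
      intro y hy
      choose c hc using hspan y hy
      refine ⟨fun i j => c j i, ?_⟩
      rw [hz, Matrix.mul_sum, Finset.sum_comm]
      refine Finset.sum_congr rfl fun j _ => ?_
      rw [← Matrix.mul_assoc, hc, Matrix.sum_mul]
      simp
    have hzyz : ∀ y ∈ Y, z * (y * z) = y * z := by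
      intro y hy
      obtain ⟨x, hx⟩ := hyz y hy
      rw [hx]
      simp only [Matrix.mul_sum, Matrix.mul_smul, ← Matrix.mul_assoc, hzw]
    -- Taking adjoints in `z y† z = y† z` gives `z y z = z y`, while `z y z = y z` holds as well.
    have hcomm : ∀ y ∈ Y, z * y = y * z := by
      intro y hy
      rw [← hzyz y hy]
      have := congrArg Matrix.conjTranspose (hzyz _ (hstar _ hy))
      simp only [Matrix.conjTranspose_mul, hzs, Matrix.conjTranspose_conjTranspose] at this
      rw [← this, Matrix.mul_assoc]
    let Y' : Submodule ℂ (Matrix ι ι ℂ) :=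
      { carrier := {a | a ∈ Y ∧ a * z = 0}
        add_mem' := fun ha hb => ⟨Y.add_mem ha.1 hb.1, by rw [Matrix.add_mul, ha.2, hb.2, add_zero]⟩
        zero_mem' := ⟨Y.zero_mem, by simp⟩
        smul_mem' := fun c a ha => ⟨Y.smul_mem c ha.1, by rw [Matrix.smul_mul, ha.2, smul_zero]⟩ }
    have hlt : Module.finrank ℂ Y' < Module.finrank ℂ Y := by
      apply Submodule.finrank_lt_finrank_of_lt
      refine lt_of_le_of_ne (fun a ha => ha.1) ?_
      intro h
      have : w ⟨0, hm⟩ ∈ Y' := h ▸ hwY _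
      have h2 : w ⟨0, hm⟩ = 0 := by
        rw [← hzw, hcomm _ (hwY _)]
        exact this.2
      have h3 := hww ⟨0, hm⟩ ⟨0, hm⟩
      rw [h2] at h3
      simp only [Matrix.mul_zero, if_true] at h3
      exact hp0 h3.symm
    obtain ⟨κ, _, n, q, v, hv⟩ := ih Y' (by omega)
      (fun a ha b hb => ⟨hmul _ ha.1 _ hb.1, by rw [Matrix.mul_assoc, hb.2, Matrix.mul_zero]⟩)
      (fun a ha => ⟨hstar _ ha.1, by
        rw [← hcomm _ (hstar _ ha.1), ← hzs, ← Matrix.conjTranspose_mul, ha.2]; simp⟩)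
    have hwv : ∀ i k j, (w i)ᴴ * v k j = 0 := by
      intro i k j
      rw [← hwz, Matrix.mul_assoc, hcomm _ (hv.mem k j).1, (hv.mem k j).2, Matrix.mul_zero]
    refine ⟨Option κ, inferInstance, fun o => o.elim m n, fun o => o.elim p q,
      fun o => match o with
        | none => w
        | some k => v k, ?_⟩
    constructor
    · rintro (_ | k)
      exacts [hm, hv.pos k]
    · rintro (_ | k)
      exacts [hp0, hv.p_ne_zero k]
    · rintro (_ | k)
      exacts [hps, hv.p_star k]
    · rintro (_ | k)
      exacts [hpp, hv.p_mul_self k]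
    · rintro (_ | k)
      exacts [hwY, fun i => (hv.mem k i).1]
    · rintro (_ | k)
      exacts [hwp, hv.mul_p k]
    · rintro (_ | k)
      exacts [hww, hv.star_mul_same k]
    · rintro (_ | k) (_ | l) hkl i j
      · exact absurd rfl hkl
      · exact hwv i l j
      · have := congrArg Matrix.conjTranspose (hwv j k i)
        rwa [Matrix.conjTranspose_mul, Matrix.conjTranspose_conjTranspose,
          Matrix.conjTranspose_zero] at this
      · exact hv.star_mul_of_ne k l (fun h => hkl (by rw [h])) i j
    · intro y hy
      obtain ⟨x, hx⟩ := hyz y hy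
      have hz2 : z * z = z := by
        nth_rw 2 [hz]
        rw [Matrix.mul_sum]
        simp only [← Matrix.mul_assoc, hzw]
        rfl
      have hy' : y - y * z ∈ Y' := ⟨Y.sub_mem hy (hmul _ hy _ hzY), by
        rw [Matrix.sub_mul, Matrix.mul_assoc, hz2, sub_self]⟩
      obtain ⟨x', hx'⟩ := hv.span _ hy'
      refine ⟨fun o => match o with
        | none => x
        | some k => x' k, ?_⟩
      rw [Fintype.sum_option]
      have : y = y * z + (y - y * z) := by abel
      rw [this, hx', hx]
      rfl

/-- Every self-adjoint subalgebra of a full matrix algebra is a direct sum of full matrix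
algebras. -/
theorem exists_isBlockSystem (Y : Submodule ℂ (Matrix ι ι ℂ))
    (hmul : ∀ a ∈ Y, ∀ b ∈ Y, a * b ∈ Y) (hstar : ∀ a ∈ Y, aᴴ ∈ Y) :
    ∃ (K : ℕ) (n : Fin K → ℕ) (p : Fin K → Matrix ι ι ℂ)
      (v : (k : Fin K) → Fin (n k) → Matrix ι ι ℂ), IsBlockSystem Y n p v := by
  obtain ⟨κ, _, n, p, v, h⟩ := exists_isBlockSystem_aux _ Y le_rfl hmul hstar
  let e := (Fintype.equivFin κ).symm
  refine ⟨Fintype.card κ, n ∘ e, p ∘ e, fun k => v (e k), fun k => h.pos _, fun k => h.p_ne_zero _,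
    fun k => h.p_star _, fun k => h.p_mul_self _, fun k => h.mem _, fun k => h.mul_p _,
    fun k => h.star_mul_same _, fun k l hkl => h.star_mul_of_ne _ _ (fun h => hkl (e.injective h)),
    fun y hy => ?_⟩
  obtain ⟨x, hx⟩ := h.span y hy
  refine ⟨fun k => x (e k), ?_⟩
  rw [hx, ← e.sum_comp]
  rfl

end BlockSystems

/-! ### Orthonormal frames adapted to a block system. -/

section Frames

set_option linter.unusedSectionVars false

variable {ι : Type*} [Fintype ι] [DecidableEq ι]

/-- Every positive semidefinite matrix is positive definite on its support. -/
theorem exists_support_isometry {σ : Matrix ι ι ℂ} (hσ : σ.PosSemidef) :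
    ∃ (r s : ℕ) (V₀ : Matrix ι (Fin r) ℂ) (V : Matrix ι (Fin s) ℂ)
      (D : Matrix (Fin s) (Fin s) ℂ), V₀ᴴ * V₀ = 1 ∧ Vᴴ * V = 1 ∧ V₀ * V₀ᴴ + V * Vᴴ = 1 ∧
      D.PosDef ∧ σ = V * D * Vᴴ := by
  classical
  obtain ⟨U, lam, hU, hU', hσU⟩ := exists_unitary_diagonal hσ.isHermitian
  have hlam : ∀ i, 0 ≤ lam i := by
    have h1 := hσ.conjTranspose_mul_mul_same U
    have h2 : Uᴴ * σ * U = Matrix.diagonal fun i => (lam i : ℂ) := by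
      have : Uᴴ * (U * Matrix.diagonal (fun i => (lam i : ℂ)) * Uᴴ) * U
        = (Uᴴ * U) * Matrix.diagonal (fun i => (lam i : ℂ)) * (Uᴴ * U) := by
          simp only [Matrix.mul_assoc]
      rw [hσU, this, hU, Matrix.one_mul, Matrix.mul_one]
    rw [h2, Matrix.posSemidef_diagonal_iff] at h1
    intro i
    exact_mod_cast h1 i
  -- The columns of `U` are sorted into kernel vectors, enumerated by `e`, and support vectors,
  -- enumerated by `f`.
  let e := (Fintype.equivFin {i // ¬ lam i ≠ 0}).symm
  let f := (Fintype.equivFin {i // lam i ≠ 0}).symm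
  have hcols : ∀ i j, ∑ a, star (U a i) * U a j = if i = j then 1 else 0 := by
    intro i j
    have := congrFun (congrFun hU i) j
    simpa [Matrix.mul_apply, Matrix.one_apply] using this
  refine ⟨_, _, U.submatrix id (fun a => (e a).1), U.submatrix id (fun a => (f a).1),
    Matrix.diagonal fun a => (lam (f a).1 : ℂ), ?_, ?_, ?_, ?_, ?_⟩
  · ext a b
    simp only [Matrix.mul_apply, Matrix.conjTranspose_apply, Matrix.submatrix_apply, id, hcols,
      Matrix.one_apply, Subtype.val_inj, e.injective.eq_iff]
  · ext a b
    simp only [Matrix.mul_apply, Matrix.conjTranspose_apply, Matrix.submatrix_apply, id, hcols,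
      Matrix.one_apply, Subtype.val_inj, f.injective.eq_iff]
  · rw [← hU']
    ext a b
    simp only [Matrix.add_apply, Matrix.mul_apply, Matrix.submatrix_apply,
      Matrix.conjTranspose_apply, id]
    rw [e.sum_comp (fun i => U a i.1 * star (U b i.1)),
      f.sum_comp (fun i => U a i.1 * star (U b i.1)), add_comm]
    exact Fintype.sum_subtype_add_sum_subtype (fun i => lam i ≠ 0)
      (fun i => U a i * star (U b i))
  · refine Matrix.PosDef.diagonal fun a => ?_
    have := lt_of_le_of_ne (hlam (f a).1) (Ne.symm (f a).2)
    exact_mod_cast this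
  · rw [hσU]
    ext a b
    rw [Matrix.mul_apply, Matrix.mul_apply]
    simp only [Matrix.submatrix_apply, Matrix.mul_diagonal, Matrix.conjTranspose_apply, id]
    rw [f.sum_comp (fun i => U a i.1 * lam i.1 * star (U b i.1)),
      ← Fintype.sum_subtype_add_sum_subtype (fun i => lam i ≠ 0)
        (fun i => U a i * lam i * star (U b i)), add_eq_left]
    refine Finset.sum_eq_zero fun i _ => ?_
    have := not_not.mp i.2
    simp [this]

/-- Apply the support decomposition to `p` itself: the core `D` is idempotent and invertible, so `D
= 1`. -/
theorem exists_range_isometry {p : Matrix ι ι ℂ} (hp0 : p ≠ 0) (hps : pᴴ = p) (hpp : p * p = p) :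
    ∃ (m : ℕ) (B : Matrix ι (Fin m) ℂ), 0 < m ∧ Bᴴ * B = 1 ∧ B * Bᴴ = p := by
  have hpsd : p.PosSemidef := by
    have := Matrix.posSemidef_conjTranspose_mul_self p
    rwa [hps, hpp] at this
  obtain ⟨-, m, -, B, D, -, hB, -, hD, hpD⟩ := exists_support_isometry hpsd
  have hcomp : Bᴴ * p * B = D := by
    have : Bᴴ * (B * D * Bᴴ) * B = (Bᴴ * B) * D * (Bᴴ * B) := by simp only [Matrix.mul_assoc]
    rw [hpD, this, hB, Matrix.one_mul, Matrix.mul_one]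
  have hDD : D * D = D := by
    have : B * D * Bᴴ * (B * D * Bᴴ) = B * (D * (Bᴴ * B) * D) * Bᴴ := by
      simp only [Matrix.mul_assoc]
    rw [hB, Matrix.mul_one, ← hpD, hpp] at this
    rw [← hcomp]
    nth_rw 3 [this]
    have h2 : Bᴴ * (B * (D * D) * Bᴴ) * B = (Bᴴ * B) * (D * D) * (Bᴴ * B) := by
      simp only [Matrix.mul_assoc]
    rw [h2, hB, Matrix.one_mul, Matrix.mul_one, hcomp]
  have hD1 : D = 1 := by
    have := hD.isUnit
    exact this.mul_left_cancel (by rw [hDD, Matrix.mul_one])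
  refine ⟨m, B, ?_, hB, ?_⟩
  · rcases Nat.eq_zero_or_pos m with rfl | h
    · exact absurd (by rw [hpD]; ext; simp [Matrix.mul_apply]) hp0
    · exact h
  · rw [hpD, hD1, Matrix.mul_one]

/-- The matrix whose columns are those of the `v k i * B k`. -/
def blockFrame {K : ℕ} {n m : Fin K → ℕ} (v : (k : Fin K) → Fin (n k) → Matrix ι ι ℂ)
    (B : (k : Fin K) → Matrix ι (Fin (m k)) ℂ) :
    Matrix ι ((k : Fin K) × (Fin (n k) × Fin (m k))) ℂ :=
  Matrix.of fun a q => (v q.1 q.2.1 * B q.1) a q.2.2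

/-- Translates tensor coordinates into matrix units. The case `ρ = 1` identifies the algebra with `⨁
M_{n k} ⊗ 1`, the case `x = ρ = 1` gives completeness of the frame, and general `ρ` serves the
peripheral space of `T`. -/
theorem blockFrame_mul_blockDiagonal_mul {K : ℕ} {n m : Fin K → ℕ}
    (v : (k : Fin K) → Fin (n k) → Matrix ι ι ℂ) (B : (k : Fin K) → Matrix ι (Fin (m k)) ℂ)
    (x : (k : Fin K) → Matrix (Fin (n k)) (Fin (n k)) ℂ)
    (ρ : (k : Fin K) → Matrix (Fin (m k)) (Fin (m k)) ℂ) :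
    blockFrame v B * Matrix.blockDiagonal' (fun k => x k ⊗ₖ ρ k) * (blockFrame v B)ᴴ
      = ∑ k, ∑ i, ∑ j, x k i j • (v k i * (B k * ρ k * (B k)ᴴ) * (v k j)ᴴ) := by
  have hassoc : ∀ k i j, v k i * (B k * ρ k * (B k)ᴴ) * (v k j)ᴴ
      = (v k i * B k) * ρ k * (v k j * B k)ᴴ := by
    intro k i j
    simp only [Matrix.conjTranspose_mul, Matrix.mul_assoc]
  simp only [hassoc]
  have hmid : ∀ a k j t,
      (blockFrame v B * Matrix.blockDiagonal' (fun k => x k ⊗ₖ ρ k)) a ⟨k, (j, t)⟩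
        = ∑ i, x k i j * (v k i * B k * ρ k) a t := by
    intro a k j t
    rw [Matrix.mul_apply, Fintype.sum_sigma, Finset.sum_eq_single k]
    · simp only [Matrix.blockDiagonal'_apply_eq, Fintype.sum_prod_type, blockFrame, Matrix.of_apply,
        Matrix.kroneckerMap_apply]
      refine Finset.sum_congr rfl fun i _ => ?_
      rw [Matrix.mul_apply (M := v k i * B k), Finset.mul_sum]
      exact Finset.sum_congr rfl fun s _ => by ring
    · intro l _ hl
      exact Finset.sum_eq_zero fun q _ => by
        rw [Matrix.blockDiagonal'_apply_ne _ _ _ hl, mul_zero]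
    · simp
  ext a b
  rw [Matrix.mul_apply, Fintype.sum_sigma]
  simp only [Matrix.sum_apply, Matrix.smul_apply, Fintype.sum_prod_type, hmid]
  refine Finset.sum_congr rfl fun k _ => ?_
  rw [Finset.sum_comm (s := Finset.univ (α := Fin (n k)))
    (f := fun i j => x k i j • (v k i * B k * ρ k * (v k j * B k)ᴴ) a b)]
  refine Finset.sum_congr rfl fun j _ => ?_
  simp only [Finset.sum_mul]
  rw [Finset.sum_comm]
  refine Finset.sum_congr rfl fun i _ => ?_
  rw [Matrix.mul_apply, smul_eq_mul, Finset.mul_sum]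
  refine Finset.sum_congr rfl fun t _ => ?_
  rw [mul_assoc]
  rfl

theorem conjTranspose_blockFrame_mul_blockFrame {K : ℕ} {n m : Fin K → ℕ}
    {Y : Submodule ℂ (Matrix ι ι ℂ)} {p : Fin K → Matrix ι ι ℂ}
    {v : (k : Fin K) → Fin (n k) → Matrix ι ι ℂ} (h : IsBlockSystem Y n p v)
    {B : (k : Fin K) → Matrix ι (Fin (m k)) ℂ} (hB : ∀ k, (B k)ᴴ * B k = 1)
    (hBp : ∀ k, B k * (B k)ᴴ = p k) :
    (blockFrame v B)ᴴ * blockFrame v B = 1 := by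
  ext ⟨k, i, s⟩ ⟨l, j, t⟩
  have h1 : ((blockFrame v B)ᴴ * blockFrame v B) ⟨k, i, s⟩ ⟨l, j, t⟩
      = ((B k)ᴴ * ((v k i)ᴴ * v l j) * B l) s t := by
    have : (B k)ᴴ * ((v k i)ᴴ * v l j) * B l = (v k i * B k)ᴴ * (v l j * B l) := by
      simp only [Matrix.conjTranspose_mul, Matrix.mul_assoc]
    rw [this, Matrix.mul_apply, Matrix.mul_apply]
    rfl
  rw [h1]
  by_cases hkl : k = l
  · subst hkl
    have hpB : p k * B k = B k := by
      rw [← hBp, Matrix.mul_assoc, hB, Matrix.mul_one]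
    rw [h.star_mul_same]
    by_cases hij : i = j
    · subst hij
      rw [if_pos rfl, Matrix.mul_assoc, hpB, hB, Matrix.one_apply, Matrix.one_apply]
      simp
    · rw [if_neg hij, Matrix.mul_zero, Matrix.zero_mul, Matrix.one_apply_ne]
      · rfl
      · simp [hij]
  · rw [h.star_mul_of_ne k l hkl, Matrix.mul_zero, Matrix.zero_mul, Matrix.one_apply_ne]
    · rfl
    · intro h'
      exact hkl (congrArg Sigma.fst h')

/-- The sum fixes every `v l j` from the left, hence everything in the span of the matrix units, to
which `1` belongs. -/
theorem IsBlockSystem.sum_eq_one {K : ℕ} {n : Fin K → ℕ}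
    {Y : Submodule ℂ (Matrix ι ι ℂ)} {p : Fin K → Matrix ι ι ℂ}
    {v : (k : Fin K) → Fin (n k) → Matrix ι ι ℂ} (h : IsBlockSystem Y n p v) (h1 : 1 ∈ Y) :
    ∑ k, ∑ i, v k i * (v k i)ᴴ = 1 := by
  have hz : ∀ l j, (∑ k, ∑ i, v k i * (v k i)ᴴ) * v l j = v l j := by
    intro l j
    rw [Matrix.sum_mul, Finset.sum_eq_single l, Matrix.sum_mul, Finset.sum_eq_single j]
    · rw [Matrix.mul_assoc, h.star_mul_same, if_pos rfl, h.mul_p]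
    · intro i _ hi
      rw [Matrix.mul_assoc, h.star_mul_same, if_neg hi, Matrix.mul_zero]
    · simp
    · intro k _ hk
      rw [Matrix.sum_mul]
      exact Finset.sum_eq_zero fun i _ => by
        rw [Matrix.mul_assoc, h.star_mul_of_ne k l hk, Matrix.mul_zero]
    · simp
  obtain ⟨x, hx⟩ := h.span 1 h1
  have : (∑ k, ∑ i, v k i * (v k i)ᴴ) * 1 = 1 := by
    rw [hx]
    simp only [Matrix.mul_sum, Matrix.mul_smul]
    refine Finset.sum_congr rfl fun k _ => Finset.sum_congr rfl fun i _ =>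
      Finset.sum_congr rfl fun j _ => ?_
    rw [← Matrix.mul_assoc, hz]
  rwa [Matrix.mul_one] at this

theorem blockFrame_mul_conjTranspose_blockFrame {K : ℕ} {n m : Fin K → ℕ}
    {Y : Submodule ℂ (Matrix ι ι ℂ)} {p : Fin K → Matrix ι ι ℂ}
    {v : (k : Fin K) → Fin (n k) → Matrix ι ι ℂ} (h : IsBlockSystem Y n p v) (h1 : 1 ∈ Y)
    {B : (k : Fin K) → Matrix ι (Fin (m k)) ℂ} (hBp : ∀ k, B k * (B k)ᴴ = p k) :
    blockFrame v B * (blockFrame v B)ᴴ = 1 := by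
  have := blockFrame_mul_blockDiagonal_mul v B (fun _ => 1) (fun _ => 1)
  simp only [Matrix.one_kronecker_one, Matrix.mul_one, hBp, h.mul_p] at this
  have hone : (Matrix.blockDiagonal' fun k =>
      (1 : Matrix (Fin (n k) × Fin (m k)) (Fin (n k) × Fin (m k)) ℂ)) = 1 :=
    Matrix.blockDiagonal'_one
  rw [hone, Matrix.mul_one] at this
  rw [this, ← h.sum_eq_one h1]
  refine Finset.sum_congr rfl fun k _ => Finset.sum_congr rfl fun i _ => ?_
  rw [Finset.sum_eq_single i]
  · simp
  · intro j _ hj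
    rw [Matrix.one_apply_ne hj.symm, zero_smul]
  · simp

end Frames

/-! ### Star automorphisms of direct sums of full matrix algebras. -/

section Automorphisms

/-- Star isomorphisms between full matrix algebras are conjugations by unitaries. -/
theorem exists_unitary_of_starAlgEquiv {a b : ℕ}
    (f : Matrix (Fin a) (Fin a) ℂ ≃⋆ₐ[ℂ] Matrix (Fin b) (Fin b) ℂ) :
    ∃ (h : a = b) (U : Matrix.unitaryGroup (Fin b) ℂ), ∀ x,
      f x = (U : Matrix (Fin b) (Fin b) ℂ) * Matrix.reindex (finCongr h) (finCongr h) x *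
        (U : Matrix (Fin b) (Fin b) ℂ)ᴴ := by
  have hab : a = b := by
    have := LinearEquiv.finrank_eq (f.toAlgEquiv.toLinearEquiv)
    simp only [Module.finrank_matrix, Fintype.card_fin, Module.finrank_self, mul_one] at this
    exact Nat.mul_self_inj.mp this
  subst hab
  refine ⟨rfl, ?_⟩
  let φ := Matrix.toEuclideanCLM (n := Fin a) (𝕜 := ℂ)
  let g := (φ.symm.trans f).trans φ
  -- Transported to operators on Euclidean space, the automorphism is implemented by a surjective
  -- isometry, which is then read back as a unitary matrix.
  obtain ⟨V, hV⟩ := StarAlgEquiv.eq_linearIsometryEquivConjStarAlgEquiv g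
    (LinearMap.continuous_of_finiteDimensional g.toAlgEquiv.toLinearMap)
  set u := Unitary.linearIsometryEquiv.symm V with hu
  have hVu : V = Unitary.linearIsometryEquiv u := by simp [hu]
  rw [hVu, Unitary.conjStarAlgEquiv_unitaryLinearIsometryEquiv] at hV
  have hstar : ∀ y, φ.symm (star y) = star (φ.symm y) := fun y => φ.symm.map_star' y
  have hmem : φ.symm (u : _ →L[ℂ] _) ∈ Matrix.unitaryGroup (Fin a) ℂ := by
    rw [Matrix.mem_unitaryGroup_iff, ← hstar, ← map_mul, Unitary.mul_star_self_of_mem u.2, map_one]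
  refine ⟨⟨_, hmem⟩, fun x => ?_⟩
  have h1 : φ (f x) = g (φ x) := by simp [g]
  rw [hV, Unitary.conjStarAlgAut_apply] at h1
  have h2 := congrArg φ.symm h1
  rw [StarAlgEquiv.symm_apply_apply, map_mul, map_mul, StarAlgEquiv.symm_apply_apply, hstar] at h2
  rw [h2]
  rfl

/-- Star automorphisms of a direct sum of full matrix algebras permute the summands up to
conjugation by unitaries. -/
theorem exists_perm_unitary_of_starAlgEquiv {K : ℕ} {n : Fin K → ℕ} (hn : ∀ k, 0 < n k)
    (α : ((k : Fin K) → Matrix (Fin (n k)) (Fin (n k)) ℂ) ≃⋆ₐ[ℂ]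
      ((k : Fin K) → Matrix (Fin (n k)) (Fin (n k)) ℂ)) :
    ∃ (U : (k : Fin K) → Matrix.unitaryGroup (Fin (n k)) ℂ)
      (π : Equiv.Perm (Fin K)) (hπ : ∀ k, n (π k) = n k), ∀ x k,
        α x k = (U k : Matrix (Fin (n k)) (Fin (n k)) ℂ) *
                Matrix.reindex (finCongr (hπ k)) (finCongr (hπ k)) (x (π k)) *
                (U k : Matrix (Fin (n k)) (Fin (n k)) ℂ)ᴴ := by
  have hne : ∀ k, Nonempty (Fin (n k)) := fun k => ⟨⟨0, hn k⟩⟩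
  have hsurj : Function.Surjective α := EquivLike.surjective α
  have hidem : ∀ k l, α (Pi.single l 1) k * α (Pi.single l 1) k = α (Pi.single l 1) k := by
    intro k l
    rw [← Pi.mul_apply, ← map_mul, ← Pi.single_mul, mul_one]
  have hcomm : ∀ k l (y : Matrix (Fin (n k)) (Fin (n k)) ℂ), Commute y (α (Pi.single l 1) k) := by
    intro k l y
    obtain ⟨x, hx⟩ := hsurj (Pi.single k y)
    have hy : y = α x k := by rw [hx, Pi.single_eq_same]
    rw [hy, Commute, SemiconjBy, ← Pi.mul_apply, ← Pi.mul_apply, ← map_mul, ← map_mul]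
    refine congrFun (congrArg α ?_) k
    ext1 j
    by_cases hj : j = l
    · subst hj; simp
    · simp [Pi.single_eq_of_ne hj]
  -- The `k`-th component of the image of a central projection is central in a full matrix algebra,
  -- thus scalar, and idempotent.
  have h01 : ∀ k l, α (Pi.single l 1) k = 0 ∨ α (Pi.single l 1) k = 1 := by
    intro k l
    obtain ⟨z, hz⟩ := Matrix.mem_range_scalar_iff_commute_single.mpr
      (fun i j (_ : i ≠ j) => hcomm k l (Matrix.single i j 1))
    have h2 := hidem k l
    rw [← hz, ← map_mul] at h2
    have h3 := Matrix.scalar_inj.mp h2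
    have h4 : z = 0 ∨ z = 1 := by
      rcases eq_or_ne z 0 with h | h
      · exact Or.inl h
      · exact Or.inr (mul_left_cancel₀ h (by rw [h3, mul_one]))
    rcases h4 with rfl | rfl
    · left; rw [← hz, map_zero]
    · right; rw [← hz, map_one]
  have hsum : ∀ k, ∑ l, α (Pi.single l 1) k = 1 := by
    intro k
    have h1 : ∑ l, (Pi.single l 1 : (k : Fin K) → Matrix (Fin (n k)) (Fin (n k)) ℂ) = 1 :=
      Finset.univ_sum_single 1
    rw [← Finset.sum_apply, ← map_sum, h1, map_one, Pi.one_apply]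
  have hex : ∀ k, ∃ l, α (Pi.single l 1) k = 1 := by
    intro k
    by_contra! hc
    have h0 : ∀ l, α (Pi.single l 1) k = 0 := fun l => (h01 k l).resolve_right (hc l)
    have := hsum k
    simp only [h0, Finset.sum_const_zero] at this
    exact zero_ne_one this
  choose π hπ using hex
  have hdep : ∀ k x, α x k = α (Pi.single (π k) (x (π k))) k := by
    intro k x
    have h1 : x * Pi.single (π k) 1 = Pi.single (π k) (x (π k)) := by
      ext1 j
      by_cases hj : j = π k
      · subst hj; simp
      · simp [Pi.single_eq_of_ne hj]
    rw [← h1, map_mul, Pi.mul_apply, hπ, mul_one]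
  let F : ∀ k, Matrix (Fin (n (π k))) (Fin (n (π k))) ℂ →⋆ₐ[ℂ] Matrix (Fin (n k)) (Fin (n k)) ℂ :=
    fun k =>
    { toFun := fun y => α (Pi.single (π k) y) k
      map_one' := hπ k
      map_mul' := fun x y => by rw [Pi.single_mul, map_mul, Pi.mul_apply]
      map_zero' := by simp
      map_add' := fun x y => by rw [Pi.single_add, map_add, Pi.add_apply]
      commutes' := fun r => by
        rw [Algebra.algebraMap_eq_smul_one, Pi.single_smul, map_smul, Pi.smul_apply, hπ,
          Algebra.algebraMap_eq_smul_one]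
      map_star' := fun x => by rw [Pi.single_star, map_star, Pi.star_apply] }
  have hF : ∀ k y, F k y = α (Pi.single (π k) y) k := fun k y => rfl
  have hFinj : ∀ k, Function.Injective (F k) := by
    intro k
    have := hne (π k)
    have := hne k
    exact RingHom.injective (F k).toAlgHom.toRingHom
  have hFsurj : ∀ k, Function.Surjective (F k) := by
    intro k y
    obtain ⟨x, hx⟩ := hsurj (Pi.single k y)
    refine ⟨x (π k), ?_⟩
    rw [hF, ← hdep, hx, Pi.single_eq_same]
  -- If two components `k ≠ k'` of `α x` were both governed by the same summand of `x`, then the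
  -- preimage of the unit of summand `k` would have to vanish there (seen from `k'`) and be nonzero
  -- there (seen from `k`).
  have hπinj : Function.Injective π := by
    intro k k' hkk
    by_contra hne'
    obtain ⟨x, hx⟩ := hsurj (Pi.single k 1)
    have h1 : F k (x (π k)) = 1 := by rw [hF, ← hdep, hx, Pi.single_eq_same]
    have h2 : F k' (x (π k')) = 0 := by
      rw [hF, ← hdep, hx, Pi.single_eq_of_ne (Ne.symm hne')]
    have h3 : x (π k') = 0 := hFinj k' (by rw [h2, map_zero])
    have h4 : x (π k) = 0 := by rw [hkk]; exact h3
    rw [h4, map_zero] at h1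
    exact zero_ne_one h1
  choose hd U hU using fun k =>
    exists_unitary_of_starAlgEquiv (StarAlgEquiv.ofBijective (F k) ⟨hFinj k, hFsurj k⟩)
  refine ⟨U, Equiv.ofBijective π (Finite.injective_iff_bijective.mp hπinj), hd, fun x k => ?_⟩
  rw [hdep]
  exact hU k (x (π k))

end Automorphisms

/-! ### A fixed point dominating all peripheral eigenvectors. -/

section FixedPoint

set_option linter.unusedSectionVars false

variable {ι : Type*} [Fintype ι] [DecidableEq ι]

open scoped MatrixOrder in
theorem span_posSemidef_eq_top :
    Submodule.span ℂ {A : Matrix ι ι ℂ | A.PosSemidef} = ⊤ := by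
  have := CStarAlgebra.span_nonneg (A := Matrix ι ι ℂ)
  simpa only [Matrix.nonneg_iff_posSemidef] using this

/-- Each eigenvalue of a positive matrix is at most the sum of them all. -/
theorem posSemidef_trace_smul_one_sub {A : Matrix ι ι ℂ} (hA : A.PosSemidef) :
    (A.trace • (1 : Matrix ι ι ℂ) - A).PosSemidef := by
  obtain ⟨U, lam, hU, hU', hAU⟩ := exists_unitary_diagonal hA.isHermitian
  have hlam : ∀ i, 0 ≤ (lam i : ℂ) := by
    have h1 := hA.conjTranspose_mul_mul_same U
    have h2 : Uᴴ * A * U = Matrix.diagonal fun i => (lam i : ℂ) := by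
      have : Uᴴ * (U * Matrix.diagonal (fun i => (lam i : ℂ)) * Uᴴ) * U
        = (Uᴴ * U) * Matrix.diagonal (fun i => (lam i : ℂ)) * (Uᴴ * U) := by
          simp only [Matrix.mul_assoc]
      rw [hAU, this, hU, Matrix.one_mul, Matrix.mul_one]
    rw [h2, Matrix.posSemidef_diagonal_iff] at h1
    exact h1
  have htr : A.trace = ∑ i, (lam i : ℂ) := by
    rw [hAU, Matrix.trace_mul_comm, ← Matrix.mul_assoc, hU, Matrix.one_mul, Matrix.trace_diagonal]
  have : A.trace • (1 : Matrix ι ι ℂ) - A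
      = U * Matrix.diagonal (fun i => A.trace - (lam i : ℂ)) * Uᴴ := by
    rw [← Matrix.diagonal_sub, Matrix.mul_sub, Matrix.sub_mul, ← hAU]
    congr 1
    rw [← hU', ← Matrix.smul_one_eq_diagonal, Matrix.mul_smul, Matrix.smul_mul, Matrix.mul_one]
  rw [this]
  apply Matrix.PosSemidef.mul_mul_conjTranspose_same
  rw [Matrix.posSemidef_diagonal_iff]
  intro i
  rw [sub_nonneg, htr]
  exact Finset.single_le_sum (f := fun i => (lam i : ℂ)) (fun j _ => hlam j) (Finset.mem_univ i)

/-- With `A = C†C`, this is `C C† ≤ tr(C C†) 1` conjugated by `C`. -/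
theorem posSemidef_trace_smul_sub_mul_self {A : Matrix ι ι ℂ} (hA : A.PosSemidef) :
    (A.trace • A - A * A).PosSemidef := by
  obtain ⟨C, rfl⟩ := exists_eq_conjTranspose_mul_self hA
  have h := (posSemidef_trace_smul_one_sub
    (Matrix.posSemidef_self_mul_conjTranspose C)).conjTranspose_mul_mul_same C
  rw [Matrix.trace_mul_comm C] at h
  convert h using 1
  simp only [Matrix.mul_sub, Matrix.sub_mul, Matrix.mul_smul, Matrix.smul_mul, Matrix.mul_one,
    Matrix.mul_assoc]

/-- The squared entries sum to `tr(A²)`, which is at most `(tr A)²`. Positive trace-preserving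
orbits are therefore bounded. -/
theorem norm_apply_le_norm_trace {A : Matrix ι ι ℂ} (hA : A.PosSemidef) (i j : ι) :
    ‖A i j‖ ≤ ‖A.trace‖ := by
  have h1 : (A.trace * A.trace - (Aᴴ * A).trace : ℂ) ≥ 0 := by
    have := (posSemidef_trace_smul_sub_mul_self hA).trace_nonneg
    rw [Matrix.trace_sub, Matrix.trace_smul, smul_eq_mul] at this
    rwa [hA.isHermitian.eq]
  have htr : A.trace = (‖A.trace‖ : ℂ) := by
    have := hA.trace_nonneg
    exact (Complex.norm_of_nonneg' this).symm
  have h2 : (Aᴴ * A).trace = ((∑ j, ∑ i, ‖A i j‖ ^ 2 : ℝ) : ℂ) := by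
    simp only [Matrix.trace, Matrix.diag_apply, Matrix.mul_apply, Matrix.conjTranspose_apply]
    push_cast
    refine Finset.sum_congr rfl fun j _ => Finset.sum_congr rfl fun i _ => ?_
    exact Complex.conj_mul' _
  rw [h2, htr] at h1
  have h3 : ∑ j, ∑ i, ‖A i j‖ ^ 2 ≤ ‖A.trace‖ ^ 2 := by
    have : (0 : ℂ) ≤ ((‖A.trace‖ ^ 2 - ∑ j, ∑ i, ‖A i j‖ ^ 2 : ℝ) : ℂ) := by
      push_cast
      push_cast at h1
      simpa [sq] using h1
    have := Complex.zero_le_real.mp this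
    linarith
  have h4 : ‖A i j‖ ^ 2 ≤ ∑ j, ∑ i, ‖A i j‖ ^ 2 :=
    (Finset.single_le_sum (f := fun i => ‖A i j‖ ^ 2) (fun _ _ => by positivity)
      (Finset.mem_univ i)).trans
    (Finset.single_le_sum (f := fun j => ∑ i, ‖A i j‖ ^ 2) (fun _ _ => by positivity)
      (Finset.mem_univ j))
  exact (sq_le_sq₀ (norm_nonneg _) (norm_nonneg _)).mp (h4.trans h3)

theorem isClosed_posSemidef : IsClosed {A : Matrix ι ι ℂ | A.PosSemidef} := by
  have : {A : Matrix ι ι ℂ | A.PosSemidef}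
      = {A | Aᴴ = A} ∩ ⋂ x : ι → ℂ, {A | 0 ≤ star x ⬝ᵥ A *ᵥ x} := by
    ext A
    simp [Matrix.posSemidef_iff_dotProduct_mulVec, Matrix.IsHermitian]
  rw [this]
  refine (isClosed_eq (by fun_prop) continuous_id).inter (isClosed_iInter fun x => ?_)
  exact isClosed_le continuous_const (by fun_prop)

/-- Positive trace-preserving linear maps. -/
structure IsPositiveTracePreserving (T : Matrix ι ι ℂ →ₗ[ℂ] Matrix ι ι ℂ) : Prop where
  positive : ∀ A, A.PosSemidef → (T A).PosSemidef
  trace_preserving : ∀ A, (T A).trace = A.trace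

namespace IsPositiveTracePreserving

variable {T : Matrix ι ι ℂ →ₗ[ℂ] Matrix ι ι ℂ}

theorem pow (hT : IsPositiveTracePreserving T) (N : ℕ) : IsPositiveTracePreserving (T ^ N) := by
  induction N with
  | zero => exact ⟨fun A hA => hA, fun A => rfl⟩
  | succ N ih =>
    refine ⟨fun A hA => ?_, fun A => ?_⟩
    · rw [pow_succ']
      exact hT.positive _ (ih.positive A hA)
    · rw [pow_succ']
      exact (hT.trace_preserving _).trans (ih.trace_preserving A)

theorem map_conjTranspose (hT : IsPositiveTracePreserving T) (A : Matrix ι ι ℂ) :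
    T Aᴴ = (T A)ᴴ := by
  have hA : A ∈ Submodule.span ℂ {A : Matrix ι ι ℂ | A.PosSemidef} := by
    rw [span_posSemidef_eq_top]; trivial
  induction hA using Submodule.span_induction with
  | mem A hA => rw [hA.isHermitian.eq, (hT.positive A hA).isHermitian.eq]
  | zero => simp
  | add A B _ _ hA hB => simp [hA, hB]
  | smul c A _ hA => simp [hA]

/-- A uniform bound for the images of a fixed matrix under all positive trace-preserving maps. -/
theorem exists_uniform_bound (Z : Matrix ι ι ℂ) : ∃ C : ℂ, 0 ≤ C ∧
    ∀ S : Matrix ι ι ℂ →ₗ[ℂ] Matrix ι ι ℂ, IsPositiveTracePreserving S →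
      (C • S 1 - (S Z)ᴴ * S Z).PosSemidef := by
  have hZ : Z ∈ Submodule.span ℂ {A : Matrix ι ι ℂ | A.PosSemidef} := by
    rw [span_posSemidef_eq_top]; trivial
  induction hZ using Submodule.span_induction with
  | mem A hA =>
    -- For positive `A`, `S(A)² ≤ tr(A) S(A) ≤ tr(A)² S(1)`. Only the trace of `A` enters, so the
    -- constant does not depend on `S`.
    refine ⟨A.trace * A.trace, mul_nonneg hA.trace_nonneg hA.trace_nonneg, fun S hS => ?_⟩
    have h1 := hS.positive _ (posSemidef_trace_smul_one_sub hA)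
    have h2 := posSemidef_trace_smul_sub_mul_self (hS.positive A hA)
    rw [hS.trace_preserving] at h2
    have h3 := (h1.smul hA.trace_nonneg).add h2
    rw [(hS.positive A hA).isHermitian.eq]
    convert h3 using 1
    rw [map_sub, map_smul, smul_sub, smul_smul]
    abel
  | zero => exact ⟨0, le_rfl, fun S _ => by simpa using Matrix.PosSemidef.zero⟩
  | add A B _ _ hA hB =>
    obtain ⟨a, ha, hA⟩ := hA
    obtain ⟨b, hb, hB⟩ := hB
    -- Parallelogram identity: `2(P†P + Q†Q) - (P+Q)†(P+Q) = (P-Q)†(P-Q)`, with `P = S A` and `Q = S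
    -- B`.
    refine ⟨2 * (a + b), by positivity, fun S hS => ?_⟩
    have h := (((hA S hS).add (hB S hS)).smul (zero_le_two (α := ℂ))).add
      (Matrix.posSemidef_conjTranspose_mul_self (S A - S B))
    convert h using 1
    simp only [map_add, Matrix.conjTranspose_add, Matrix.conjTranspose_sub, Matrix.add_mul,
      Matrix.mul_add, Matrix.sub_mul, Matrix.mul_sub, smul_add, smul_sub, two_smul, mul_smul,
      add_smul]
    abel
  | smul c A _ hA =>
    obtain ⟨a, ha, hA⟩ := hA
    refine ⟨star c * c * a, mul_nonneg (star_mul_self_nonneg c) ha, fun S hS => ?_⟩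
    have h := (hA S hS).smul (star_mul_self_nonneg c)
    convert h using 1
    simp only [map_smul, Matrix.conjTranspose_smul, Matrix.smul_mul, Matrix.mul_smul, smul_sub,
      smul_smul]
    ring_nf

/-- A positive trace-preserving map has a fixed point that dominates all its peripheral
eigenvectors. -/
theorem exists_dominating_fixedPoint (hT : IsPositiveTracePreserving T) :
    ∃ σ : Matrix ι ι ℂ, σ.PosSemidef ∧ T σ = σ ∧
      ∀ (Z : Matrix ι ι ℂ) (lam : ℂ), star lam * lam = 1 → T Z = lam • Z →
        ∃ C : ℂ, (C • σ - Zᴴ * Z).PosSemidef := by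
  -- `a N • S N` is the Cesàro mean of the `N + 1` matrices `T^0(1), …, T^N(1)`; `σ` is a limit
  -- point of these means.
  let S : ℕ → Matrix ι ι ℂ := fun N => ∑ l ∈ Finset.range (N + 1), (T ^ l) 1
  let a : ℕ → ℂ := fun N => ((N : ℂ) + 1)⁻¹
  have ha : ∀ N, 0 ≤ a N := fun N => by
    simp only [a]
    positivity
  have ha' : ∀ N, ‖a N‖ = ((N : ℝ) + 1)⁻¹ := fun N => by
    simp only [a, norm_inv]
    rw [show (N : ℂ) + 1 = ((N + 1 : ℕ) : ℂ) by push_cast; rfl, Complex.norm_natCast]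
    push_cast
    rfl
  set R : ℝ := ‖(1 : Matrix ι ι ℂ).trace‖
  have hone : ∀ N i j, ‖(T ^ N) 1 i j‖ ≤ R := by
    intro N i j
    have h := norm_apply_le_norm_trace ((hT.pow N).positive 1 Matrix.PosSemidef.one) i j
    rwa [(hT.pow N).trace_preserving] at h
  have hbound : ∀ N, (fun i j => (a N • S N) i j) ∈ Metric.closedBall (0 : ι → ι → ℂ) R := by
    intro N
    rw [mem_closedBall_zero_iff, pi_norm_le_iff_of_nonneg (norm_nonneg _)]
    intro i
    rw [pi_norm_le_iff_of_nonneg (norm_nonneg _)]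
    intro j
    have hS : S N i j = ∑ l ∈ Finset.range (N + 1), (T ^ l) 1 i j := Matrix.sum_apply ..
    rw [Matrix.smul_apply, norm_smul, ha', hS, inv_mul_le_iff₀ (by positivity)]
    refine (norm_sum_le _ _).trans ((Finset.sum_le_sum fun l _ => hone l i j).trans ?_)
    rw [Finset.sum_const, Finset.card_range, nsmul_eq_mul]
    push_cast
    exact le_rfl
  obtain ⟨σ, φ, hφ, hlim'⟩ : ∃ (σ : Matrix ι ι ℂ) (φ : ℕ → ℕ), StrictMono φ ∧
      Filter.Tendsto (fun N => a (φ N) • S (φ N)) Filter.atTop (nhds σ) := by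
    obtain ⟨σ, -, φ, hφ, hlim⟩ := tendsto_subseq_of_bounded Metric.isBounded_closedBall hbound
    exact ⟨σ, φ, hφ, hlim⟩
  have hpsd : ∀ N, (a N • S N).PosSemidef := fun N =>
    (Matrix.posSemidef_sum _ fun l _ => (hT.pow l).positive 1 Matrix.PosSemidef.one).smul (ha N)
  refine ⟨σ, isClosed_posSemidef.mem_of_tendsto hlim'
    (Filter.Eventually.of_forall fun N => hpsd _), ?_, ?_⟩
  · have hcont : Continuous T := LinearMap.continuous_of_finiteDimensional T
    have h1 : Filter.Tendsto (fun N => T (a (φ N) • S (φ N)) - a (φ N) • S (φ N)) Filter.atTop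
        (nhds (T σ - σ)) := ((hcont.tendsto _).comp hlim').sub hlim'
    -- The sum telescopes, and the bounded remainder divided by `N + 1` tends to zero, so the limit
    -- is fixed.
    have h2 : ∀ N, T (a N • S N) - a N • S N = a N • ((T ^ (N + 1)) 1 - 1) := by
      intro N
      rw [map_smul, ← smul_sub]
      congr 1
      have h3 : T (S N) = ∑ l ∈ Finset.range (N + 1), (T ^ (l + 1)) 1 := by
        simp only [S, map_sum, pow_succ']
        rfl
      rw [h3, ← Finset.sum_sub_distrib, Finset.sum_range_sub (fun l => (T ^ l) 1)]
      rfl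
    have h3 : Filter.Tendsto (fun N => T (a (φ N) • S (φ N)) - a (φ N) • S (φ N)) Filter.atTop
        (nhds 0) := by
      refine tendsto_pi_nhds.mpr fun i => tendsto_pi_nhds.mpr fun j => ?_
      have h4 : Filter.Tendsto (fun N : ℕ => 2 * R * ((N : ℝ) + 1)⁻¹) Filter.atTop (nhds 0) := by
        have := (tendsto_one_div_add_atTop_nhds_zero_nat (𝕜 := ℝ)).const_mul (2 * R)
        simpa using this
      refine squeeze_zero_norm (fun N => ?_) (h4.comp hφ.tendsto_atTop)
      rw [h2, Matrix.smul_apply, norm_smul, ha', Matrix.sub_apply, mul_comm]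
      refine mul_le_mul_of_nonneg_right ?_ (by positivity)
      refine (norm_sub_le _ _).trans ?_
      rw [two_mul]
      exact add_le_add (hone _ i j) (hone 0 i j)
    exact sub_eq_zero.mp (tendsto_nhds_unique h1 h3)
  · intro Z lam hlam hZ
    obtain ⟨C, hC0, hC⟩ := exists_uniform_bound Z
    refine ⟨C, ?_⟩
    have hpow : ∀ l, (T ^ l) Z = lam ^ l • Z := by
      intro l
      induction l with
      | zero => simp
      | succ l ih =>
        rw [pow_succ', Module.End.mul_apply, ih, map_smul, hZ, smul_smul, pow_succ]
    -- The uniform bound for the map `T^l`, combined with `T^l Z = lam^l Z`: the phase cancels in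
    -- `Z†Z`, so the inequality survives averaging and passing to the limit.
    have hterm : ∀ l, (C • (T ^ l) 1 - Zᴴ * Z).PosSemidef := by
      intro l
      have := hC _ (hT.pow l)
      rwa [hpow, Matrix.conjTranspose_smul, Matrix.smul_mul, Matrix.mul_smul, smul_smul,
        star_pow, ← mul_pow, hlam, one_pow, one_smul] at this
    have hmean : ∀ N, (C • (a N • S N) - Zᴴ * Z).PosSemidef := by
      intro N
      have h := (Matrix.posSemidef_sum (Finset.range (N + 1)) fun l _ => hterm l).smul (ha N)
      convert h using 1
      have hN : a N * (N + 1 : ℂ) = 1 := inv_mul_cancel₀ (by exact_mod_cast Nat.succ_ne_zero N)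
      rw [Finset.sum_sub_distrib, Finset.sum_const, Finset.card_range, smul_sub,
        ← Nat.cast_smul_eq_nsmul ℂ, smul_smul (a N)]
      push_cast
      rw [hN, one_smul, ← Finset.smul_sum, smul_comm]
    exact isClosed_posSemidef.mem_of_tendsto ((hlim'.const_smul C).sub tendsto_const_nhds)
      (Filter.Eventually.of_forall fun N => hmean _)

end IsPositiveTracePreserving

end FixedPoint

/-! ### Multiplicativity of the dual and the bimodule structure of `X_T`. -/

section Peripheral

set_option linter.unusedSectionVars false

variable {ι : Type*} [Fintype ι] [DecidableEq ι]

theorem posSemidef_of_forall_add_nsmul {P N : Matrix ι ι ℂ}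
    (h : ∀ l : ℕ, (P + (l : ℂ) • N).PosSemidef) : N.PosSemidef := by
  have hlim : Filter.Tendsto (fun l : ℕ => ((l : ℂ) + 1)⁻¹ • P + N) Filter.atTop (nhds N) := by
    have h1 : Filter.Tendsto (fun l : ℕ => ((l : ℂ) + 1)⁻¹) Filter.atTop (nhds 0) := by
      simpa using tendsto_one_div_add_atTop_nhds_zero_nat (𝕜 := ℂ)
    simpa using (h1.smul_const P).add_const N
  refine isClosed_posSemidef.mem_of_tendsto hlim (Filter.Eventually.of_forall fun l => ?_)
  have hl : (0 : ℂ) ≤ ((l : ℂ) + 1)⁻¹ := by positivity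
  have h2 := (h (l + 1)).smul hl
  rw [smul_add, smul_smul] at h2
  push_cast at h2
  rwa [inv_mul_cancel₀ (by exact_mod_cast Nat.succ_ne_zero l), one_smul] at h2

theorem eq_zero_of_posSemidef_of_posSemidef_neg {N : Matrix ι ι ℂ} (h : N.PosSemidef)
    (h' : (-N).PosSemidef) : N = 0 := by
  rw [← h.trace_eq_zero_iff]
  refine le_antisymm ?_ h.trace_nonneg
  have := h'.trace_nonneg
  rwa [Matrix.trace_neg, Left.nonneg_neg_iff] at this

/-- For large `t` the linear terms outweigh `P`, so `u M + ū M† ≥ 0` for every `u`. Taking `u = ±1`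
and `u = ±i` makes the hermitian and antihermitian parts of `M` vanish. -/
theorem eq_zero_of_forall_posSemidef {P M : Matrix ι ι ℂ}
    (h : ∀ t : ℂ, (P + t • M + star t • Mᴴ).PosSemidef) : M = 0 := by
  have key : ∀ u : ℂ, (u • M + star u • Mᴴ).PosSemidef := by
    intro u
    apply posSemidef_of_forall_add_nsmul (P := P)
    intro l
    have := h (l * u)
    rwa [star_mul', star_natCast, mul_smul, mul_smul, add_assoc, ← smul_add] at this
  have h1 : M + Mᴴ = 0 := by
    apply eq_zero_of_posSemidef_of_posSemidef_neg
    · simpa using key 1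
    · have := key (-1)
      simp only [star_neg, star_one, neg_smul, one_smul] at this
      rwa [neg_add]
  have h2 : Complex.I • M - Complex.I • Mᴴ = 0 := by
    apply eq_zero_of_posSemidef_of_posSemidef_neg
    · have := key Complex.I
      rwa [Complex.star_def, Complex.conj_I, neg_smul, ← sub_eq_add_neg] at this
    · have := key (-Complex.I)
      rw [star_neg, Complex.star_def, Complex.conj_I, neg_neg, neg_smul] at this
      rwa [neg_sub, sub_eq_neg_add]
  have h3 : M = Mᴴ := by
    rw [← smul_sub, smul_eq_zero] at h2
    exact sub_eq_zero.mp (h2.resolve_left Complex.I_ne_zero)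
  rw [← h3, ← two_smul ℂ, smul_eq_zero] at h1
  exact h1.resolve_left two_ne_zero

/-- Faithfulness of the functional `tr(· D)`: for `F = G†G` the trace is that of the positive matrix
`G D G†`, which must vanish, and `D` is invertible. -/
theorem eq_zero_of_trace_mul_posDef_eq_zero {F D : Matrix ι ι ℂ} (hF : F.PosSemidef)
    (hD : D.PosDef) (h : (F * D).trace = 0) : F = 0 := by
  obtain ⟨G, rfl⟩ := exists_eq_conjTranspose_mul_self hF
  obtain ⟨C, hC⟩ := exists_eq_conjTranspose_mul_self hD.posSemidef
  have h1 : G * D * Gᴴ = 0 := by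
    rw [← (hD.posSemidef.mul_mul_conjTranspose_same G).trace_eq_zero_iff, Matrix.trace_mul_comm,
      ← Matrix.mul_assoc, h]
  have h2 : C * Gᴴ = 0 := by
    apply eq_zero_of_conjTranspose_mul_self_eq_zero
    rw [Matrix.conjTranspose_mul, Matrix.conjTranspose_conjTranspose, ← h1, hC]
    simp only [Matrix.mul_assoc]
  have h3 : D * Gᴴ = D * 0 := by
    rw [hC, Matrix.mul_assoc, h2, Matrix.mul_zero, Matrix.mul_zero]
  rw [hD.isUnit.mul_left_cancel h3, Matrix.zero_mul]

theorem eq_of_forall_trace_mul_eq {A B : Matrix ι ι ℂ}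
    (h : ∀ C, (A * C).trace = (B * C).trace) : A = B :=
  Matrix.ext_iff_trace_mul_right.mpr h

/-- The span of the eigenvectors to eigenvalues of modulus one. -/
def peripheralSpan (f : Matrix ι ι ℂ →ₗ[ℂ] Matrix ι ι ℂ) : Submodule ℂ (Matrix ι ι ℂ) :=
  Submodule.span ℂ {X | ∃ lam : ℂ, star lam * lam = 1 ∧ f X = lam • X}

/-- `E` is the dual of the positive trace-preserving map `T` and satisfies the Schwarz
inequality. -/
structure IsSchwarzPair (T E : Matrix ι ι ℂ →ₗ[ℂ] Matrix ι ι ℂ) : Prop where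
  dual : ∀ A B, (E A * B).trace = (A * T B).trace
  positive : ∀ A, A.PosSemidef → (T A).PosSemidef
  trace_preserving : ∀ A, (T A).trace = A.trace
  schwarz : ∀ A, (E (Aᴴ * A) - E Aᴴ * E A).PosSemidef

namespace IsSchwarzPair

variable {T E : Matrix ι ι ℂ →ₗ[ℂ] Matrix ι ι ℂ}

theorem isPositiveTracePreserving (h : IsSchwarzPair T E) : IsPositiveTracePreserving T :=
  ⟨h.positive, h.trace_preserving⟩

theorem map_one (h : IsSchwarzPair T E) : E 1 = 1 := by
  apply eq_of_forall_trace_mul_eq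
  intro C
  rw [h.dual, Matrix.one_mul, Matrix.one_mul, h.trace_preserving]

theorem dual_conjTranspose (h : IsSchwarzPair T E) (A : Matrix ι ι ℂ) : E Aᴴ = (E A)ᴴ := by
  apply eq_of_forall_trace_mul_eq
  intro C
  have h1 := h.dual A Cᴴ
  rw [h.isPositiveTracePreserving.map_conjTranspose] at h1
  have h2 := congrArg star h1
  rw [← Matrix.trace_conjTranspose, ← Matrix.trace_conjTranspose, Matrix.conjTranspose_mul,
    Matrix.conjTranspose_mul, Matrix.conjTranspose_conjTranspose,
    Matrix.conjTranspose_conjTranspose] at h2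
  rw [h.dual, Matrix.trace_mul_comm, ← h2, Matrix.trace_mul_comm]

theorem dual_positive (h : IsSchwarzPair T E) {A : Matrix ι ι ℂ} (hA : A.PosSemidef) :
    (E A).PosSemidef := by
  obtain ⟨C, rfl⟩ := exists_eq_conjTranspose_mul_self hA
  have h1 := (h.schwarz C).add (Matrix.posSemidef_conjTranspose_mul_self (E C))
  rwa [h.dual_conjTranspose, sub_add_cancel] at h1

/-- The multiplicative domain argument. In the Schwarz inequality for `B† + t A` the `|t|²` terms
cancel by hypothesis, leaving a constant plus terms linear in `t` and its conjugate, whose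
coefficients must vanish. -/
theorem map_mul_of_map_conjTranspose_mul_self (h : IsSchwarzPair T E) {A : Matrix ι ι ℂ}
    (hA : E (Aᴴ * A) = E Aᴴ * E A) (B : Matrix ι ι ℂ) : E (B * A) = E B * E A := by
  rw [← sub_eq_zero]
  apply eq_zero_of_forall_posSemidef (P := E (B * Bᴴ) - E B * E Bᴴ)
  intro t
  have h1 := h.schwarz (Bᴴ + t • A)
  convert h1 using 1
  have h2 : (E (B * A) - E B * E A)ᴴ = E (Aᴴ * Bᴴ) - E Aᴴ * E Bᴴ := by
    rw [Matrix.conjTranspose_sub, Matrix.conjTranspose_mul, ← h.dual_conjTranspose,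
      ← h.dual_conjTranspose, ← h.dual_conjTranspose, Matrix.conjTranspose_mul]
  rw [h2]
  simp only [Matrix.conjTranspose_add, Matrix.conjTranspose_conjTranspose,
    Matrix.conjTranspose_smul, Matrix.add_mul, Matrix.mul_add, Matrix.smul_mul, Matrix.mul_smul,
    map_add, map_smul, hA, smul_sub, smul_add]
  abel

variable {σ : Matrix ι ι ℂ}

/-- Against the fixed point both terms of the Schwarz defect have trace `tr(A†A σ)`, since `|μ| =
1`. -/
theorem map_conjTranspose_mul_self (h : IsSchwarzPair T E) (hσ : σ.PosDef) (hfix : T σ = σ)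
    {A : Matrix ι ι ℂ} {μ : ℂ} (hμ : star μ * μ = 1) (hA : E A = μ • A) :
    E (Aᴴ * A) = E Aᴴ * E A := by
  rw [← sub_eq_zero]
  refine eq_zero_of_trace_mul_posDef_eq_zero (h.schwarz A) hσ ?_
  rw [Matrix.sub_mul, Matrix.trace_sub, h.dual, hfix, h.dual_conjTranspose, hA,
    Matrix.conjTranspose_smul, Matrix.smul_mul, Matrix.mul_smul, smul_smul, hμ, one_smul, sub_self]

/-- Multiplicativity against all `B` is linear in `A`, unlike equality in the Schwarz inequality, so
it extends from eigenvectors to their span. -/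
theorem map_mul_right (h : IsSchwarzPair T E) (hσ : σ.PosDef) (hfix : T σ = σ)
    {A : Matrix ι ι ℂ} (hA : A ∈ peripheralSpan E) (B : Matrix ι ι ℂ) :
    E (B * A) = E B * E A := by
  induction hA using Submodule.span_induction with
  | mem A hA =>
    obtain ⟨μ, hμ, hA⟩ := hA
    exact h.map_mul_of_map_conjTranspose_mul_self (h.map_conjTranspose_mul_self hσ hfix hμ hA) B
  | zero => simp
  | add A A' _ _ hA hA' => simp [Matrix.mul_add, hA, hA']
  | smul c A _ hA => simp [hA]

theorem conjTranspose_mem (h : IsSchwarzPair T E)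
    {A : Matrix ι ι ℂ} (hA : A ∈ peripheralSpan E) : Aᴴ ∈ peripheralSpan E := by
  induction hA using Submodule.span_induction with
  | mem A hA =>
    obtain ⟨μ, hμ, hA⟩ := hA
    refine Submodule.subset_span ⟨star μ, by rwa [star_star, mul_comm], ?_⟩
    rw [h.dual_conjTranspose, hA, Matrix.conjTranspose_smul]
  | zero => simp
  | add A A' _ _ hA hA' => rw [Matrix.conjTranspose_add]; exact Submodule.add_mem _ hA hA'
  | smul c A _ hA => rw [Matrix.conjTranspose_smul]; exact Submodule.smul_mem _ _ hA

theorem map_mul_left (h : IsSchwarzPair T E) (hσ : σ.PosDef) (hfix : T σ = σ)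
    {A : Matrix ι ι ℂ} (hA : A ∈ peripheralSpan E) (B : Matrix ι ι ℂ) :
    E (A * B) = E A * E B := by
  have h1 := congrArg Matrix.conjTranspose (h.map_mul_right hσ hfix (h.conjTranspose_mem hA) Bᴴ)
  rwa [Matrix.conjTranspose_mul, ← h.dual_conjTranspose, ← h.dual_conjTranspose,
    ← h.dual_conjTranspose, Matrix.conjTranspose_mul, Matrix.conjTranspose_conjTranspose,
    Matrix.conjTranspose_conjTranspose] at h1

theorem one_mem (h : IsSchwarzPair T E) : 1 ∈ peripheralSpan E :=
  Submodule.subset_span ⟨1, by simp, by rw [h.map_one, one_smul]⟩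

theorem mul_mem (h : IsSchwarzPair T E) (hσ : σ.PosDef) (hfix : T σ = σ)
    {A B : Matrix ι ι ℂ} (hA : A ∈ peripheralSpan E) (hB : B ∈ peripheralSpan E) :
    A * B ∈ peripheralSpan E := by
  refine Submodule.span_induction₂ (p := fun A B _ _ => A * B ∈ peripheralSpan E)
    ?_ (by simp) (by simp) ?_ ?_ ?_ ?_ hA hB
  · rintro A B ⟨μ, hμ, hA⟩ ⟨ν, hν, hB⟩
    refine Submodule.subset_span ⟨μ * ν, ?_, ?_⟩
    · rw [star_mul', mul_mul_mul_comm, hμ, hν, one_mul]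
    · rw [h.map_mul_right hσ hfix (Submodule.subset_span ⟨ν, hν, hB⟩), hA, hB, Matrix.smul_mul,
        Matrix.mul_smul, smul_smul]
  · intro A A' B _ _ _ h1 h2
    rw [Matrix.add_mul]; exact Submodule.add_mem _ h1 h2
  · intro A A' B _ _ _ h1 h2
    rw [Matrix.mul_add]; exact Submodule.add_mem _ h1 h2
  · intro c A B _ _ h1
    rw [Matrix.smul_mul]; exact Submodule.smul_mem _ _ h1
  · intro c A B _ _ h1
    rw [Matrix.mul_smul]; exact Submodule.smul_mem _ _ h1

theorem injOn (h : IsSchwarzPair T E) (hσ : σ.PosDef) (hfix : T σ = σ)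
    {A : Matrix ι ι ℂ} (hA : A ∈ peripheralSpan E) (h0 : E A = 0) : A = 0 := by
  apply eq_zero_of_conjTranspose_mul_self_eq_zero
  refine eq_zero_of_trace_mul_posDef_eq_zero (Matrix.posSemidef_conjTranspose_mul_self A) hσ ?_
  nth_rw 1 [← hfix]
  rw [← h.dual, h.map_mul_right hσ hfix hA, h0, Matrix.mul_zero, Matrix.zero_mul, Matrix.trace_zero]

theorem map_mem {A : Matrix ι ι ℂ} (hA : A ∈ peripheralSpan E) : E A ∈ peripheralSpan E := by
  induction hA using Submodule.span_induction with
  | mem A hA =>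
    obtain ⟨μ, hμ, hA⟩ := hA
    rw [hA]
    exact Submodule.smul_mem _ _ (Submodule.subset_span ⟨μ, hμ, hA⟩)
  | zero => simp
  | add A A' _ _ hA hA' => rw [map_add]; exact Submodule.add_mem _ hA hA'
  | smul c A _ hA => rw [map_smul]; exact Submodule.smul_mem _ _ hA

theorem exists_preimage {A : Matrix ι ι ℂ} (hA : A ∈ peripheralSpan E) :
    ∃ A' ∈ peripheralSpan E, E A' = A := by
  induction hA using Submodule.span_induction with
  | mem A hA =>
    obtain ⟨μ, hμ, hA⟩ := hA
    refine ⟨star μ • A, Submodule.smul_mem _ _ (Submodule.subset_span ⟨μ, hμ, hA⟩), ?_⟩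
    rw [map_smul, hA, smul_smul, hμ, one_smul]
  | zero => exact ⟨0, Submodule.zero_mem _, map_zero _⟩
  | add A A' _ _ hA hA' =>
    obtain ⟨B, hB, rfl⟩ := hA
    obtain ⟨B', hB', rfl⟩ := hA'
    exact ⟨B + B', Submodule.add_mem _ hB hB', map_add _ _ _⟩
  | smul c A _ hA =>
    obtain ⟨B, hB, rfl⟩ := hA
    exact ⟨c • B, Submodule.smul_mem _ _ hB, map_smul _ _ _⟩

/-- The dual form of multiplicativity: `tr(C T(E(A)Z)) = tr(E(C)E(A)Z) = tr(E(CA)Z) = tr(C A T(Z))`.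
-/
theorem map_dual_mul (h : IsSchwarzPair T E) (hσ : σ.PosDef) (hfix : T σ = σ)
    {A : Matrix ι ι ℂ} (hA : A ∈ peripheralSpan E) (Z : Matrix ι ι ℂ) :
    T (E A * Z) = A * T Z := by
  apply eq_of_forall_trace_mul_eq
  intro C
  rw [Matrix.trace_mul_comm, ← h.dual, ← Matrix.mul_assoc, ← h.map_mul_right hσ hfix hA, h.dual,
    Matrix.mul_assoc, Matrix.trace_mul_comm]

theorem map_mul_dual (h : IsSchwarzPair T E) (hσ : σ.PosDef) (hfix : T σ = σ)
    {A : Matrix ι ι ℂ} (hA : A ∈ peripheralSpan E) (Z : Matrix ι ι ℂ) :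
    T (Z * E A) = T Z * A := by
  apply eq_of_forall_trace_mul_eq
  intro C
  rw [Matrix.trace_mul_comm, ← h.dual, ← Matrix.mul_assoc, Matrix.trace_mul_comm,
    ← Matrix.mul_assoc, ← h.map_mul_left hσ hfix hA, h.dual, Matrix.mul_assoc,
    Matrix.trace_mul_comm, Matrix.mul_assoc, Matrix.trace_mul_comm C, Matrix.mul_assoc]

/-- For eigenvectors `E A = μ A` and `T Z = ν Z`, the product `A Z` is an eigenvector of `T` to `μ̄
ν`. -/
theorem mul_mem_peripheralSpan (h : IsSchwarzPair T E) (hσ : σ.PosDef) (hfix : T σ = σ)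
    {A Z : Matrix ι ι ℂ} (hA : A ∈ peripheralSpan E) (hZ : Z ∈ peripheralSpan T) :
    A * Z ∈ peripheralSpan T := by
  refine Submodule.span_induction₂ (p := fun A Z _ _ => A * Z ∈ peripheralSpan T)
    ?_ (by simp) (by simp) ?_ ?_ ?_ ?_ hA hZ
  · rintro A Z ⟨μ, hμ, hA⟩ ⟨ν, hν, hZ⟩
    refine Submodule.subset_span ⟨star μ * ν, ?_, ?_⟩
    · rw [star_mul', star_star, mul_mul_mul_comm, hν, mul_one, mul_comm, hμ]
    · have h1 := h.map_dual_mul hσ hfix (Submodule.subset_span ⟨μ, hμ, hA⟩) Z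
      rw [hA, hZ, Matrix.smul_mul, map_smul, Matrix.mul_smul] at h1
      rw [mul_smul, ← h1, smul_smul, hμ, one_smul]
  · intro A A' B _ _ _ h1 h2
    rw [Matrix.add_mul]; exact Submodule.add_mem _ h1 h2
  · intro A A' B _ _ _ h1 h2
    rw [Matrix.mul_add]; exact Submodule.add_mem _ h1 h2
  · intro c A B _ _ h1
    rw [Matrix.smul_mul]; exact Submodule.smul_mem _ _ h1
  · intro c A B _ _ h1
    rw [Matrix.mul_smul]; exact Submodule.smul_mem _ _ h1

theorem mem_peripheralSpan_mul (h : IsSchwarzPair T E) (hσ : σ.PosDef) (hfix : T σ = σ)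
    {A Z : Matrix ι ι ℂ} (hZ : Z ∈ peripheralSpan T) (hA : A ∈ peripheralSpan E) :
    Z * A ∈ peripheralSpan T := by
  refine Submodule.span_induction₂ (p := fun Z A _ _ => Z * A ∈ peripheralSpan T)
    ?_ (by simp) (by simp) ?_ ?_ ?_ ?_ hZ hA
  · rintro Z A ⟨ν, hν, hZ⟩ ⟨μ, hμ, hA⟩
    refine Submodule.subset_span ⟨star μ * ν, ?_, ?_⟩
    · rw [star_mul', star_star, mul_mul_mul_comm, hν, mul_one, mul_comm, hμ]
    · have h1 := h.map_mul_dual hσ hfix (Submodule.subset_span ⟨μ, hμ, hA⟩) Z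
      rw [hA, hZ, Matrix.mul_smul, map_smul, Matrix.smul_mul] at h1
      rw [mul_smul, ← h1, smul_smul, hμ, one_smul]
  · intro A A' B _ _ _ h1 h2
    rw [Matrix.add_mul]; exact Submodule.add_mem _ h1 h2
  · intro A A' B _ _ _ h1 h2
    rw [Matrix.mul_add]; exact Submodule.add_mem _ h1 h2
  · intro c A B _ _ h1
    rw [Matrix.smul_mul]; exact Submodule.smul_mem _ _ h1
  · intro c A B _ _ h1
    rw [Matrix.mul_smul]; exact Submodule.smul_mem _ _ h1

/-- The bilinear trace pairing turns `E` into the transpose of `T`, so no conjugate of `lam`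
appears. -/
theorem finrank_ker_dual_sub (h : IsSchwarzPair T E) (lam : ℂ) :
    Module.finrank ℂ (LinearMap.ker (E - lam • LinearMap.id))
      = Module.finrank ℂ (LinearMap.ker (T - lam • LinearMap.id)) := by
  let Φ : Matrix ι ι ℂ →ₗ[ℂ] Module.Dual ℂ (Matrix ι ι ℂ) :=
    { toFun := fun A => Matrix.traceLinearMap ι ℂ ℂ ∘ₗ LinearMap.mulLeft ℂ A
      map_add' := fun A B => by ext; simp [Matrix.add_mul]
      map_smul' := fun c A => by ext; simp }
  have hΦ : ∀ A B, Φ A B = (A * B).trace := fun A B => rfl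
  have hinj : Function.Injective Φ := by
    intro A B hAB
    exact eq_of_forall_trace_mul_eq fun C => by rw [← hΦ, ← hΦ, hAB]
  let e := LinearMap.linearEquivOfInjective Φ hinj Subspace.dual_finrank_eq.symm
  have hker : (LinearMap.ker (E - lam • LinearMap.id)).map (e : _ →ₗ[ℂ] _)
      = LinearMap.ker (T - lam • LinearMap.id).dualMap := by
    rw [Submodule.map_equiv_eq_comap_symm]
    ext ψ
    obtain ⟨A, rfl⟩ := e.surjective ψ
    simp only [Submodule.mem_comap, LinearEquiv.coe_coe, LinearEquiv.symm_apply_apply,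
      LinearMap.mem_ker]
    have h1 : (T - lam • LinearMap.id).dualMap (e A) =
        Φ ((E - lam • LinearMap.id : Matrix ι ι ℂ →ₗ[ℂ] Matrix ι ι ℂ) A) := by
      ext1 B
      change (A * (T B - lam • B)).trace = ((E A - lam • A) * B).trace
      simp [Matrix.mul_sub, Matrix.sub_mul, h.dual]
    rw [h1]
    exact (map_eq_zero_iff Φ hinj).symm
  rw [← LinearEquiv.finrank_map_eq e, hker, LinearMap.ker_dualMap_eq_dualAnnihilator_range]
  have h2 := Subspace.finrank_add_finrank_dualAnnihilator_eq
    (LinearMap.range (T - lam • LinearMap.id))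
  have h3 := LinearMap.finrank_range_add_finrank_ker (T - lam • LinearMap.id)
  omega

/-- Right multiplication by `σ` embeds `ker(E - μ)` into `ker(T - μ̄)`, which has the dimension of
`ker(E - μ̄)`. Using this for both `μ` and `μ̄` forces equal dimensions, so the embedding is onto.
-/
theorem exists_eq_mul_fixedPoint (h : IsSchwarzPair T E) (hσ : σ.PosDef) (hfix : T σ = σ)
    {Z : Matrix ι ι ℂ} {lam : ℂ} (hlam : star lam * lam = 1) (hZ : T Z = lam • Z) :
    ∃ A ∈ peripheralSpan E, Z = A * σ := by
  let R := LinearMap.mulRight ℂ σ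
  have hR : Function.Injective R := fun A B hAB => hσ.isUnit.mul_right_cancel hAB
  have hle : ∀ μ : ℂ, star μ * μ = 1 → (LinearMap.ker (E - μ • LinearMap.id)).map R
      ≤ LinearMap.ker (T - star μ • LinearMap.id) := by
    rintro μ hμ _ ⟨A, hA, rfl⟩
    have hA' : E A = μ • A := by simpa [sub_eq_zero] using hA
    have h1 := h.map_dual_mul hσ hfix (Submodule.subset_span ⟨μ, hμ, hA'⟩) σ
    rw [hA', hfix, Matrix.smul_mul, map_smul] at h1
    have h2 : T (A * σ) = star μ • (A * σ) := by
      conv_rhs => rw [← h1]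
      rw [smul_smul, hμ, one_smul]
    simpa [R, sub_eq_zero] using h2
  have hfin : ∀ μ : ℂ, star μ * μ = 1 → Module.finrank ℂ (LinearMap.ker (E - μ • LinearMap.id))
      ≤ Module.finrank ℂ (LinearMap.ker (E - star μ • LinearMap.id)) := by
    intro μ hμ
    rw [h.finrank_ker_dual_sub (star μ), (Submodule.equivMapOfInjective R hR _).finrank_eq]
    exact Submodule.finrank_mono (hle μ hμ)
  have hlam' : star (star lam) * star lam = 1 := by rwa [star_star, mul_comm]
  have heq := Submodule.eq_of_le_of_finrank_le (hle (star lam) hlam') (by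
    rw [star_star, ← h.finrank_ker_dual_sub lam, ← (Submodule.equivMapOfInjective R hR _).finrank_eq]
    exact hfin lam hlam)
  have hZk : Z ∈ LinearMap.ker (T - star (star lam) • LinearMap.id) := by
    simpa [sub_eq_zero] using hZ
  rw [← heq] at hZk
  obtain ⟨A, hA, hAZ⟩ := hZk
  have hA' : E A = star lam • A := by simpa [sub_eq_zero] using hA
  exact ⟨A, Submodule.subset_span ⟨_, hlam', hA'⟩, hAZ.symm⟩

/-- Allows `σ` to be replaced by a better adapted `τ`. One inclusion is the module property; the
other is a dimension count, as multiplication by either invertible matrix is injective. -/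
theorem peripheralSpan_eq_map_mulRight (h : IsSchwarzPair T E) (hσ : σ.PosDef) (hfix : T σ = σ)
    {τ : Matrix ι ι ℂ} (hτ : τ ∈ peripheralSpan T) (hτu : IsUnit τ) :
    (peripheralSpan E).map (LinearMap.mulRight ℂ τ) = peripheralSpan T := by
  have hle : peripheralSpan T ≤ (peripheralSpan E).map (LinearMap.mulRight ℂ σ) := by
    rw [peripheralSpan, Submodule.span_le]
    rintro Z ⟨lam, hlam, hZ⟩
    obtain ⟨A, hA, rfl⟩ := h.exists_eq_mul_fixedPoint hσ hfix hlam hZ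
    exact ⟨A, hA, rfl⟩
  have hinj : ∀ ρ : Matrix ι ι ℂ, IsUnit ρ → Function.Injective (LinearMap.mulRight ℂ ρ) :=
    fun ρ hρ A B hAB => hρ.mul_right_cancel hAB
  apply Submodule.eq_of_le_of_finrank_le
  · rintro _ ⟨A, hA, rfl⟩
    exact h.mul_mem_peripheralSpan hσ hfix hA hτ
  · rw [← (Submodule.equivMapOfInjective _ (hinj τ hτu) (peripheralSpan E)).finrank_eq,
      (Submodule.equivMapOfInjective _ (hinj σ hσ.isUnit) (peripheralSpan E)).finrank_eq]
    exact Submodule.finrank_mono hle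

end IsSchwarzPair

end Peripheral

/-! ### Calculus of `⨁ x_k ⊗ ρ_k` in a frame. -/

section BlockEmbedding

set_option linter.unusedSectionVars false

variable {ι : Type*} [Fintype ι] [DecidableEq ι] {K : ℕ} {n m : Fin K → ℕ}

/-- The matrix `⨁ₖ xₖ ⊗ ρₖ` in the frame `W`. -/
def blockEmbed (W : Matrix ι ((k : Fin K) × (Fin (n k) × Fin (m k))) ℂ)
    (x : (k : Fin K) → Matrix (Fin (n k)) (Fin (n k)) ℂ)
    (ρ : (k : Fin K) → Matrix (Fin (m k)) (Fin (m k)) ℂ) : Matrix ι ι ℂ :=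
  W * Matrix.blockDiagonal' (fun k => x k ⊗ₖ ρ k) * Wᴴ

variable {W : Matrix ι ((k : Fin K) × (Fin (n k) × Fin (m k))) ℂ}

theorem blockEmbed_mul (hW : Wᴴ * W = 1) (x y : (k : Fin K) → Matrix (Fin (n k)) (Fin (n k)) ℂ)
    (ρ τ : (k : Fin K) → Matrix (Fin (m k)) (Fin (m k)) ℂ) :
    blockEmbed W x ρ * blockEmbed W y τ = blockEmbed W (x * y) (ρ * τ) := by
  simp only [blockEmbed, Pi.mul_apply, Matrix.mul_kronecker_mul, Matrix.blockDiagonal'_mul]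
  have : ∀ P Q : Matrix ((k : Fin K) × (Fin (n k) × Fin (m k)))
      ((k : Fin K) × (Fin (n k) × Fin (m k))) ℂ,
      W * P * Wᴴ * (W * Q * Wᴴ) = W * P * (Wᴴ * W) * Q * Wᴴ := by
    intro P Q
    simp only [Matrix.mul_assoc]
  rw [this, hW, Matrix.mul_one, Matrix.mul_assoc W]

theorem blockEmbed_conjTranspose (x : (k : Fin K) → Matrix (Fin (n k)) (Fin (n k)) ℂ)
    (ρ : (k : Fin K) → Matrix (Fin (m k)) (Fin (m k)) ℂ) :
    (blockEmbed W x ρ)ᴴ = blockEmbed W (star x) (star ρ) := by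
  simp only [blockEmbed, Matrix.conjTranspose_mul, Matrix.conjTranspose_conjTranspose,
    Matrix.blockDiagonal'_conjTranspose, Matrix.conjTranspose_kronecker, Matrix.mul_assoc]
  rfl

theorem blockEmbed_add (x y : (k : Fin K) → Matrix (Fin (n k)) (Fin (n k)) ℂ)
    (ρ : (k : Fin K) → Matrix (Fin (m k)) (Fin (m k)) ℂ) :
    blockEmbed W (x + y) ρ = blockEmbed W x ρ + blockEmbed W y ρ := by
  simp only [blockEmbed, Pi.add_apply, Matrix.add_kronecker]
  rw [← Matrix.add_mul, ← Matrix.mul_add, ← Matrix.blockDiagonal'_add]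
  rfl

theorem blockEmbed_smul (c : ℂ) (x : (k : Fin K) → Matrix (Fin (n k)) (Fin (n k)) ℂ)
    (ρ : (k : Fin K) → Matrix (Fin (m k)) (Fin (m k)) ℂ) :
    blockEmbed W (c • x) ρ = c • blockEmbed W x ρ := by
  simp only [blockEmbed, Pi.smul_apply, Matrix.smul_kronecker]
  rw [← Matrix.smul_mul, ← Matrix.mul_smul, ← Matrix.blockDiagonal'_smul]
  rfl

theorem blockEmbed_one (hW : W * Wᴴ = 1) :
    blockEmbed W (1 : (k : Fin K) → Matrix (Fin (n k)) (Fin (n k)) ℂ) 1 = 1 := by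
  have hone : (Matrix.blockDiagonal' fun k =>
      (1 : Matrix (Fin (n k) × Fin (m k)) (Fin (n k) × Fin (m k)) ℂ)) = 1 :=
    Matrix.blockDiagonal'_one
  simp only [blockEmbed, Pi.one_apply, Matrix.one_kronecker_one]
  rw [hone, Matrix.mul_one, hW]

/-- Tracing out the second tensor factor recovers `x k` up to the nonzero number `tr (ρ k)`. -/
theorem blockEmbed_injective (hW : Wᴴ * W = 1)
    {ρ : (k : Fin K) → Matrix (Fin (m k)) (Fin (m k)) ℂ} (hρ : ∀ k, (ρ k).trace ≠ 0) :
    Function.Injective fun x => blockEmbed W x ρ := by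
  intro x y hxy
  have hcancel : ∀ P : Matrix ((k : Fin K) × (Fin (n k) × Fin (m k)))
      ((k : Fin K) × (Fin (n k) × Fin (m k))) ℂ, Wᴴ * (W * P * Wᴴ) * W = P := by
    intro P
    have : Wᴴ * (W * P * Wᴴ) * W = (Wᴴ * W) * P * (Wᴴ * W) := by simp only [Matrix.mul_assoc]
    rw [this, hW, Matrix.one_mul, Matrix.mul_one]
  have h1 := congrArg (fun P => Wᴴ * P * W) hxy
  simp only [blockEmbed, hcancel] at h1
  have h2 := Matrix.blockDiagonal'_injective h1
  ext k i j
  have h3 : ∀ s, x k i j * ρ k s s = y k i j * ρ k s s := fun s =>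
    congrFun (congrFun (congrFun h2 k) (i, s)) (j, s)
  apply mul_right_cancel₀ (hρ k)
  simp only [Matrix.trace, Finset.mul_sum, Matrix.diag_apply, h3]

theorem trace_blockEmbed (hW : Wᴴ * W = 1) (x : (k : Fin K) → Matrix (Fin (n k)) (Fin (n k)) ℂ)
    (ρ : (k : Fin K) → Matrix (Fin (m k)) (Fin (m k)) ℂ) :
    (blockEmbed W x ρ).trace = ∑ k, (x k).trace * (ρ k).trace := by
  rw [blockEmbed, Matrix.trace_mul_comm, ← Matrix.mul_assoc, hW, Matrix.one_mul,
    Matrix.trace_blockDiagonal']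
  simp only [Matrix.trace_kronecker]

end BlockEmbedding

/-! ### Structure of the peripheral space for an invertible fixed point. -/

section Faithful

set_option linter.unusedSectionVars false

variable {ι : Type*} [Fintype ι] [DecidableEq ι]

/-- In the frame of its block system, a unital self-adjoint subalgebra is `⨁ₖ M_{nₖ} ⊗ 1`. -/
theorem IsBlockSystem.mem_iff {K : ℕ} {n m : Fin K → ℕ}
    {Y : Submodule ℂ (Matrix ι ι ℂ)} {p : Fin K → Matrix ι ι ℂ}
    {v : (k : Fin K) → Fin (n k) → Matrix ι ι ℂ} (h : IsBlockSystem Y n p v)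
    (hmul : ∀ a ∈ Y, ∀ b ∈ Y, a * b ∈ Y) (hstar : ∀ a ∈ Y, aᴴ ∈ Y)
    {B : (k : Fin K) → Matrix ι (Fin (m k)) ℂ} (hBp : ∀ k, B k * (B k)ᴴ = p k)
    (y : Matrix ι ι ℂ) : y ∈ Y ↔ ∃ x, y = blockEmbed (blockFrame v B) x 1 := by
  have hform : ∀ x, blockEmbed (blockFrame v B) x 1
      = ∑ k, ∑ i, ∑ j, x k i j • (v k i * (v k j)ᴴ) := by
    intro x
    simp only [blockEmbed, blockFrame_mul_blockDiagonal_mul, Pi.one_apply, Matrix.mul_one, hBp,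
      h.mul_p]
  simp only [hform]
  refine ⟨fun hy => h.span y hy, ?_⟩
  rintro ⟨x, rfl⟩
  exact Y.sum_mem fun k _ => Y.sum_mem fun i _ => Y.sum_mem fun j _ =>
    Y.smul_mem _ (hmul _ (h.mem k i) _ (hstar _ (h.mem k j)))

variable {T E : Matrix ι ι ℂ →ₗ[ℂ] Matrix ι ι ℂ} {σ : Matrix ι ι ℂ}

/-- There is a frame in which the peripheral space of `E` is `⨁ₖ M_{nₖ} ⊗ 1` and that of `T` is
`⨁ₖ M_{nₖ} ⊗ ρₖ`. -/
theorem IsSchwarzPair.exists_frame (h : IsSchwarzPair T E) (hσ : σ.PosDef) (hfix : T σ = σ) :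
    ∃ (K : ℕ) (n m : Fin K → ℕ) (W : Matrix ι ((k : Fin K) × (Fin (n k) × Fin (m k))) ℂ)
      (ρ : (k : Fin K) → Matrix (Fin (m k)) (Fin (m k)) ℂ),
      (∀ k, 0 < n k) ∧ (∀ k, 0 < m k) ∧ Wᴴ * W = 1 ∧ W * Wᴴ = 1 ∧
      (∀ k, (ρ k).PosDef ∧ (ρ k).trace = 1) ∧
      (∀ A, A ∈ peripheralSpan E ↔ ∃ x, A = blockEmbed W x 1) ∧
      (∀ X, X ∈ peripheralSpan T ↔ ∃ x, X = blockEmbed W x ρ) := by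
  have hmul : ∀ a ∈ peripheralSpan E, ∀ b ∈ peripheralSpan E, a * b ∈ peripheralSpan E :=
    fun a ha b hb => h.mul_mem hσ hfix ha hb
  have hstar : ∀ a ∈ peripheralSpan E, aᴴ ∈ peripheralSpan E := fun a ha => h.conjTranspose_mem ha
  obtain ⟨K, n, p, v, hv⟩ := exists_isBlockSystem (peripheralSpan E) hmul hstar
  choose m B hm hB hBp using fun k =>
    exists_range_isometry (hv.p_ne_zero k) (hv.p_star k) (hv.p_mul_self k)
  have hpB : ∀ k, p k * B k = B k := fun k => by rw [← hBp, Matrix.mul_assoc, hB, Matrix.mul_one]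
  have hW := conjTranspose_blockFrame_mul_blockFrame hv hB hBp
  have hW' := blockFrame_mul_conjTranspose_blockFrame hv h.one_mem hBp
  have hY := fun A => hv.mem_iff (B := B) hmul hstar hBp A
  set W := blockFrame v B with hWdef
  -- `C k` spans one copy of the second factor of block `k`; `ρ k` is `σ` compressed to it and
  -- normalised. It need not be shown that `σ` itself factorises.
  let C : (k : Fin K) → Matrix ι (Fin (m k)) ℂ := fun k => v k ⟨0, hv.pos k⟩ * B k
  have hC : ∀ k, (C k)ᴴ * C k = 1 := by
    intro k
    have : (C k)ᴴ * C k = (B k)ᴴ * ((v k ⟨0, hv.pos k⟩)ᴴ * v k ⟨0, hv.pos k⟩) * B k := by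
      simp only [C, Matrix.conjTranspose_mul, Matrix.mul_assoc]
    rw [this, hv.star_mul_same, if_pos rfl, Matrix.mul_assoc, hpB, hB]
  have hρ₀ : ∀ k, ((C k)ᴴ * σ * C k).PosDef := by
    intro k
    refine hσ.conjTranspose_mul_mul_same fun a b hab => ?_
    have := congrArg (fun u => (C k)ᴴ *ᵥ u) hab
    simpa [Matrix.mulVec_mulVec, hC] using this
  have ht : ∀ k, 0 < ((C k)ᴴ * σ * C k).trace := by
    intro k
    have : Nonempty (Fin (m k)) := ⟨⟨0, hm k⟩⟩
    exact (hρ₀ k).trace_pos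
  let ρ : (k : Fin K) → Matrix (Fin (m k)) (Fin (m k)) ℂ := fun k =>
    ((C k)ᴴ * σ * C k).trace⁻¹ • ((C k)ᴴ * σ * C k)
  have hρ : ∀ k, (ρ k).PosDef := fun k => (hρ₀ k).smul (inv_pos.mpr (ht k))
  have hρtr : ∀ k, (ρ k).trace = 1 := fun k => by
    rw [Matrix.trace_smul, smul_eq_mul, inv_mul_cancel₀ (ht k).ne']
  have hσX : σ ∈ peripheralSpan T := Submodule.subset_span ⟨1, by simp, by rw [hfix, one_smul]⟩
  have hτX : blockEmbed W 1 ρ ∈ peripheralSpan T := by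
    rw [blockEmbed, hWdef, blockFrame_mul_blockDiagonal_mul]
    refine Submodule.sum_mem _ fun k _ => Submodule.sum_mem _ fun i _ => Submodule.sum_mem _
      fun j _ => Submodule.smul_mem _ _ ?_
    -- Each piece of `⨁ 1 ⊗ ρ_k` is a multiple of `a σ b` with matrix units `a`, `b` of the algebra,
    -- hence peripheral by the bimodule property.
    have h1 : v k i * (B k * ρ k * (B k)ᴴ) * (v k j)ᴴ = ((C k)ᴴ * σ * C k).trace⁻¹ •
        ((v k i * (v k ⟨0, hv.pos k⟩)ᴴ) * σ * (v k ⟨0, hv.pos k⟩ * (v k j)ᴴ)) := by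
      have h2 : v k i * (B k * (B k)ᴴ) = v k i := by rw [hBp, hv.mul_p]
      have h3 : (B k * (B k)ᴴ) * (v k j)ᴴ = (v k j)ᴴ := by
        have := congrArg Matrix.conjTranspose (hv.mul_p k j)
        rwa [Matrix.conjTranspose_mul, hv.p_star, ← hBp] at this
      conv_rhs => rw [← h2, ← h3]
      simp only [ρ, C, Matrix.mul_smul, Matrix.smul_mul, Matrix.conjTranspose_mul,
        Matrix.mul_assoc]
    rw [h1]
    refine Submodule.smul_mem _ _ (h.mem_peripheralSpan_mul hσ hfix
      (h.mul_mem_peripheralSpan hσ hfix ?_ hσX) ?_)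
    · exact hmul _ (hv.mem k i) _ (hstar _ (hv.mem k _))
    · exact hmul _ (hv.mem k _) _ (hstar _ (hv.mem k j))
  have hτu : IsUnit (blockEmbed W 1 ρ) := by
    have h1 : blockEmbed W 1 ρ * blockEmbed W 1 (fun k => (ρ k)⁻¹) = 1 := by
      rw [blockEmbed_mul hW]
      have : (ρ * fun k => (ρ k)⁻¹) = 1 := by
        ext1 k
        exact Matrix.mul_nonsing_inv _ ((Matrix.isUnit_iff_isUnit_det _).mp (hρ k).isUnit)
      rw [this, mul_one, blockEmbed_one hW']
    exact IsUnit.of_mul_eq_one _ h1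
  refine ⟨K, n, m, W, ρ, hv.pos, hm, hW, hW', fun k => ⟨hρ k, hρtr k⟩, hY, fun X => ?_⟩
  rw [← h.peripheralSpan_eq_map_mulRight hσ hfix hτX hτu]
  constructor
  · rintro ⟨A, hA, rfl⟩
    obtain ⟨x, rfl⟩ := (hY A).mp hA
    exact ⟨x, by rw [LinearMap.mulRight_apply, blockEmbed_mul hW, mul_one, one_mul]⟩
  · rintro ⟨x, rfl⟩
    exact ⟨blockEmbed W x 1, (hY _).mpr ⟨x, rfl⟩, by
      rw [LinearMap.mulRight_apply, blockEmbed_mul hW, mul_one, one_mul]⟩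

/-- `α` is the inverse of the restriction of `E`, the direction needed to read `T(E(A) Z) = A T(Z)`
as a formula for `T`. Its algebraic properties follow from those of `E` by injectivity. -/
theorem IsSchwarzPair.exists_starAlgEquiv (h : IsSchwarzPair T E) (hσ : σ.PosDef) (hfix : T σ = σ)
    {K : ℕ} {n m : Fin K → ℕ} {W : Matrix ι ((k : Fin K) × (Fin (n k) × Fin (m k))) ℂ}
    (hm : ∀ k, 0 < m k) (hW : Wᴴ * W = 1) (hW' : W * Wᴴ = 1)
    (hY : ∀ A, A ∈ peripheralSpan E ↔ ∃ x, A = blockEmbed W x 1) :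
    ∃ α : ((k : Fin K) → Matrix (Fin (n k)) (Fin (n k)) ℂ) ≃⋆ₐ[ℂ]
      ((k : Fin K) → Matrix (Fin (n k)) (Fin (n k)) ℂ),
      ∀ x, E (blockEmbed W (α x) 1) = blockEmbed W x 1 := by
  have hinj := blockEmbed_injective (W := W) hW (ρ := 1) fun k => by
    simp [(hm k).ne']
  have hmem : ∀ x, blockEmbed W x 1 ∈ peripheralSpan E := fun x => (hY _).mpr ⟨x, rfl⟩
  have hex : ∀ x, ∃ y, E (blockEmbed W y 1) = blockEmbed W x 1 := by
    intro x
    obtain ⟨A, hA, hAx⟩ := exists_preimage (hmem x)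
    obtain ⟨y, rfl⟩ := (hY A).mp hA
    exact ⟨y, hAx⟩
  choose α hα using hex
  have huniq : ∀ x y, E (blockEmbed W x 1) = E (blockEmbed W y 1) → x = y := by
    intro x y hxy
    apply hinj
    rw [← sub_eq_zero]
    exact h.injOn hσ hfix (Submodule.sub_mem _ (hmem x) (hmem y)) (by rw [map_sub, hxy, sub_self])
  let F : ((k : Fin K) → Matrix (Fin (n k)) (Fin (n k)) ℂ) →⋆ₐ[ℂ]
      ((k : Fin K) → Matrix (Fin (n k)) (Fin (n k)) ℂ) :=
    { toFun := α
      map_one' := huniq _ _ (by rw [hα, blockEmbed_one hW', h.map_one])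
      map_mul' := fun x y => huniq _ _ (by
        have h1 : ∀ x y, blockEmbed W (x * y) 1 = blockEmbed W x 1 * blockEmbed W y 1 := by
          intro x y
          rw [blockEmbed_mul hW, mul_one]
        rw [hα, h1, h1, h.map_mul_right hσ hfix (hmem _), hα, hα])
      map_zero' := huniq _ _ (by
        have h0 : blockEmbed W 0 1 = 0 := by simpa using blockEmbed_smul (W := W) 0 0 1
        rw [hα, h0, map_zero])
      map_add' := fun x y => huniq _ _ (by
        rw [hα, blockEmbed_add, blockEmbed_add, map_add, hα, hα])
      commutes' := fun c => huniq _ _ (by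
        rw [hα, Algebra.algebraMap_eq_smul_one, blockEmbed_smul, map_smul, blockEmbed_one hW',
          h.map_one])
      map_star' := fun x => huniq _ _ (by
        have h1 : ∀ x, blockEmbed W (star x) 1 = (blockEmbed W x 1)ᴴ := by
          intro x
          rw [blockEmbed_conjTranspose, star_one]
        rw [hα, h1, h1, h.dual_conjTranspose, hα]) }
  have hbij : Function.Bijective F := by
    constructor
    · intro x y hxy
      apply hinj
      change blockEmbed W x 1 = blockEmbed W y 1
      rw [← hα x, ← hα y]
      exact congrArg (fun z => E (blockEmbed W z 1)) hxy
    · intro y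
      obtain ⟨x, hx⟩ := (hY _).mp (map_mem (hmem y))
      exact ⟨x, huniq _ _ (by rw [hx]; exact hα x)⟩
  exact ⟨StarAlgEquiv.ofBijective F hbij, hα⟩

/-- The structure of the peripheral space of a Schwarz map with a faithful fixed point. -/
theorem IsSchwarzPair.exists_structure (h : IsSchwarzPair T E) (hσ : σ.PosDef) (hfix : T σ = σ) :
    ∃ (K : ℕ) (n m : Fin K → ℕ) (W : Matrix ι ((k : Fin K) × (Fin (n k) × Fin (m k))) ℂ)
      (ρ : (k : Fin K) → Matrix (Fin (m k)) (Fin (m k)) ℂ),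
      (∀ k, 0 < n k) ∧ (∀ k, 0 < m k) ∧ Wᴴ * W = 1 ∧ W * Wᴴ = 1 ∧
      (∀ k, (ρ k).PosDef ∧ (ρ k).trace = 1) ∧
      (∀ X, X ∈ peripheralSpan T ↔ ∃ x, X = blockEmbed W x ρ) ∧
      ∃ (U : (k : Fin K) → Matrix.unitaryGroup (Fin (n k)) ℂ)
        (π : Equiv.Perm (Fin K)) (hπ : ∀ k, n (π k) = n k), ∀ x,
          T (blockEmbed W x ρ) = blockEmbed W (fun k => (U k : Matrix (Fin (n k)) (Fin (n k)) ℂ) *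
                Matrix.reindex (finCongr (hπ k)) (finCongr (hπ k)) (x (π k)) *
                (U k : Matrix (Fin (n k)) (Fin (n k)) ℂ)ᴴ) ρ := by
  obtain ⟨K, n, m, W, ρ, hn, hm, hW, hW', hρ, hY, hX⟩ := h.exists_frame hσ hfix
  refine ⟨K, n, m, W, ρ, hn, hm, hW, hW', hρ, hX, ?_⟩
  obtain ⟨α, hα⟩ := h.exists_starAlgEquiv hσ hfix hm hW hW' hY
  obtain ⟨U, π, hπ, hU⟩ := exists_perm_unitary_of_starAlgEquiv hn α
  refine ⟨U, π, hπ, ?_⟩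
  have hinj := blockEmbed_injective (W := W) hW (ρ := ρ) fun k => by rw [(hρ k).2]; exact one_ne_zero
  have hmem : ∀ x, blockEmbed W x 1 ∈ peripheralSpan E := fun x => (hY _).mpr ⟨x, rfl⟩
  -- `z` measures how far `T` is from fixing `⨁ 1 ⊗ ρ_k`. Multiplying from the left and from the
  -- right shows that `z` commutes with the range of `α`, that is, with everything.
  obtain ⟨z, hz⟩ := (hX _).mp (map_mem ((hX (blockEmbed W 1 ρ)).mpr ⟨1, rfl⟩))
  have hleft : ∀ x, T (blockEmbed W x ρ) = blockEmbed W (α x * z) ρ := by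
    intro x
    have h1 := h.map_dual_mul hσ hfix (hmem (α x)) (blockEmbed W 1 ρ)
    rwa [hα, hz, blockEmbed_mul hW, blockEmbed_mul hW, mul_one, one_mul] at h1
  have hright : ∀ x, T (blockEmbed W x ρ) = blockEmbed W (z * α x) ρ := by
    intro x
    have h1 := h.map_mul_dual hσ hfix (hmem (α x)) (blockEmbed W 1 ρ)
    rwa [hα, hz, blockEmbed_mul hW, blockEmbed_mul hW, mul_one, one_mul] at h1
  have hcomm : ∀ y, y * z = z * y := by
    intro y
    obtain ⟨x, rfl⟩ := EquivLike.surjective α y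
    exact hinj ((hleft x).symm.trans (hright x))
  have hscalar : ∀ k, ∃ c : ℂ, z k = c • 1 := by
    intro k
    obtain ⟨c, hc⟩ := Matrix.mem_range_scalar_iff_commute_single.mpr
      (fun i j (_ : i ≠ j) => show Commute (Matrix.single i j 1) (z k) by
        have h1 := congrFun (hcomm (Pi.single k (Matrix.single i j 1))) k
        rw [Commute, SemiconjBy]
        simpa using h1)
    exact ⟨c, by rw [← hc, Matrix.smul_one_eq_diagonal]; rfl⟩
  choose c hc using hscalar
  have htr : ∀ x : (k : Fin K) → Matrix (Fin (n k)) (Fin (n k)) ℂ, ∑ k, (x k).trace = ∑ k, c k * (x (π k)).trace := by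
    intro x
    have h1 := h.trace_preserving (blockEmbed W x ρ)
    rw [hleft, trace_blockEmbed hW, trace_blockEmbed hW] at h1
    simp only [(hρ _).2, mul_one, Pi.mul_apply, hc, Matrix.mul_smul, Matrix.trace_smul, hU,
      smul_eq_mul] at h1
    rw [← h1]
    refine Finset.sum_congr rfl fun k _ => ?_
    rw [Matrix.trace_mul_comm, ← Matrix.mul_assoc]
    have h2 : (U k : Matrix (Fin (n k)) (Fin (n k)) ℂ)ᴴ * U k = 1 :=
      Matrix.mem_unitaryGroup_iff'.mp (U k).2
    rw [h2, Matrix.one_mul]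
    congr 1
    simp only [Matrix.trace, Matrix.diag_apply, Matrix.reindex_apply, Matrix.submatrix_apply]
    exact Equiv.sum_comp (finCongr (hπ k)).symm fun i => x (π k) i i
  have hc1 : ∀ k, c k = 1 := by
    intro k
    -- Testing trace preservation on the unit of summand `π k` yields `n (π k) = c k * n (π k)`.
    have h1 := htr (Pi.single (π k) 1)
    rw [Finset.sum_eq_single (π k) (fun l _ hl => by rw [Pi.single_eq_of_ne hl, Matrix.trace_zero])
      (by simp), Finset.sum_eq_single k (fun l _ hl => by
        rw [Pi.single_eq_of_ne (fun h => hl (π.injective h)), Matrix.trace_zero, mul_zero])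
      (by simp), Pi.single_eq_same, Matrix.trace_one, Fintype.card_fin] at h1
    have h2 : ((n (π k) : ℕ) : ℂ) ≠ 0 := by exact_mod_cast (hn (π k)).ne'
    exact (mul_right_cancel₀ h2 (by rw [one_mul]; exact h1)).symm
  intro x
  rw [hleft]
  congr 1
  ext1 k
  rw [Pi.mul_apply, hc, hc1, one_smul, Matrix.mul_one, hU]

end Faithful

/-! ### Reduction to the support of the fixed point. -/

section Compression

set_option linter.unusedSectionVars false

variable {ι κ : Type*} [Fintype ι] [DecidableEq ι] [Fintype κ] [DecidableEq κ]

/-- The compression `A ↦ V† f(V A V†) V`. -/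
def compression (V : Matrix ι κ ℂ) (f : Matrix ι ι ℂ →ₗ[ℂ] Matrix ι ι ℂ) :
    Matrix κ κ ℂ →ₗ[ℂ] Matrix κ κ ℂ where
  toFun A := Vᴴ * f (V * A * Vᴴ) * V
  map_add' A B := by simp only [Matrix.mul_add, Matrix.add_mul, map_add]
  map_smul' c A := by simp only [Matrix.mul_smul, Matrix.smul_mul, map_smul, RingHom.id_apply]

theorem compression_apply (V : Matrix ι κ ℂ) (f : Matrix ι ι ℂ →ₗ[ℂ] Matrix ι ι ℂ)
    (A : Matrix κ κ ℂ) : compression V f A = Vᴴ * f (V * A * Vᴴ) * V := rfl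

variable {T E : Matrix ι ι ℂ →ₗ[ℂ] Matrix ι ι ℂ}

/-- For the Schwarz inequality, compress that of `E` at `V A V†` by `V` and add the positive term
with `1 - V V†` in the middle, which turns the inner `1` into `V V†`. Trace preservation is where
invariance of the corner enters. -/
theorem IsSchwarzPair.compress (h : IsSchwarzPair T E) {V : Matrix ι κ ℂ} (hV : Vᴴ * V = 1)
    (hVT : ∀ A, T (V * A * Vᴴ) = V * compression V T A * Vᴴ) :
    IsSchwarzPair (compression V T) (compression V E) where
  dual A B := by
    have h1 : (compression V E A * B).trace = (E (V * A * Vᴴ) * (V * B * Vᴴ)).trace := by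
      rw [compression_apply, Matrix.mul_assoc, Matrix.mul_assoc, Matrix.trace_mul_comm]
      simp only [Matrix.mul_assoc]
    rw [h1, h.dual, compression_apply, Matrix.mul_assoc, Matrix.mul_assoc, Matrix.trace_mul_comm]
    simp only [Matrix.mul_assoc]
  positive A hA := (h.positive _ (hA.mul_mul_conjTranspose_same V)).conjTranspose_mul_mul_same V
  trace_preserving A := by
    have h1 := h.trace_preserving (V * A * Vᴴ)
    rw [hVT] at h1
    have h2 : ∀ B : Matrix κ κ ℂ, (V * B * Vᴴ).trace = B.trace := by
      intro B
      rw [Matrix.trace_mul_comm, ← Matrix.mul_assoc, hV, Matrix.one_mul]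
    rwa [h2, h2] at h1
  schwarz A := by
    have h1 := (h.schwarz (V * A * Vᴴ)).conjTranspose_mul_mul_same V
    have hQ : (1 - V * Vᴴ).PosSemidef := by
      have h2 := Matrix.posSemidef_conjTranspose_mul_self (1 - V * Vᴴ)
      have h3 : (1 - V * Vᴴ)ᴴ * (1 - V * Vᴴ) = 1 - V * Vᴴ := by
        have h4 : V * Vᴴ * (V * Vᴴ) = V * Vᴴ := by
          rw [Matrix.mul_assoc, ← Matrix.mul_assoc Vᴴ, hV, Matrix.one_mul]
        rw [Matrix.conjTranspose_sub, Matrix.conjTranspose_mul, Matrix.conjTranspose_conjTranspose,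
          Matrix.conjTranspose_one, Matrix.sub_mul, Matrix.one_mul, Matrix.mul_sub, Matrix.mul_one,
          h4, sub_self, sub_zero]
      rwa [h3] at h2
    have h5 := h1.add (hQ.conjTranspose_mul_mul_same (E (V * A * Vᴴ) * V))
    have hadj : (V * A * Vᴴ)ᴴ = V * Aᴴ * Vᴴ := by
      simp only [Matrix.conjTranspose_mul, Matrix.conjTranspose_conjTranspose, Matrix.mul_assoc]
    have hsq : (V * A * Vᴴ)ᴴ * (V * A * Vᴴ) = V * (Aᴴ * A) * Vᴴ := by
      have : V * Aᴴ * Vᴴ * (V * A * Vᴴ) = V * Aᴴ * (Vᴴ * V) * A * Vᴴ := by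
        simp only [Matrix.mul_assoc]
      rw [hadj, this, hV, Matrix.mul_one, Matrix.mul_assoc V]
    convert h5 using 1
    rw [hsq, hadj, Matrix.conjTranspose_mul, ← h.dual_conjTranspose, hadj]
    simp only [compression_apply, Matrix.mul_sub, Matrix.sub_mul, Matrix.mul_one, Matrix.mul_assoc]
    abel

/-- A positive trace-preserving map leaves the corner of the support of a fixed point
invariant. -/
theorem IsSchwarzPair.map_corner (h : IsSchwarzPair T E) {r s : ℕ}
    {V₀ : Matrix ι (Fin r) ℂ} {V : Matrix ι (Fin s) ℂ} {D : Matrix (Fin s) (Fin s) ℂ}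
    (hsum : V₀ * V₀ᴴ + V * Vᴴ = 1) (h0 : V₀ᴴ * V = 0)
    (hD : D.PosDef) (hfix : T (V * D * Vᴴ) = V * D * Vᴴ) (A : Matrix (Fin s) (Fin s) ℂ) :
    T (V * A * Vᴴ) = V * compression V T A * Vᴴ := by
  -- With `Q = V₀ V₀†` and `σ = V D V†`, `tr(E(Q) σ) = tr(Q T(σ)) = tr(Q σ) = 0`, and `D` is
  -- positive definite.
  have hF : Vᴴ * E (V₀ * V₀ᴴ) * V = 0 := by
    refine eq_zero_of_trace_mul_posDef_eq_zero ((h.dual_positive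
      (Matrix.posSemidef_self_mul_conjTranspose V₀)).conjTranspose_mul_mul_same V) hD ?_
    have h1 : (Vᴴ * E (V₀ * V₀ᴴ) * V * D).trace = (E (V₀ * V₀ᴴ) * (V * D * Vᴴ)).trace := by
      rw [Matrix.mul_assoc, Matrix.mul_assoc, Matrix.trace_mul_comm]
      simp only [Matrix.mul_assoc]
    have h2 : V₀ * V₀ᴴ * (V * D * Vᴴ) = V₀ * (V₀ᴴ * V) * D * Vᴴ := by simp only [Matrix.mul_assoc]
    rw [h1, h.dual, hfix, h2, h0]
    simp
  -- For positive `A` the image is positive with zero trace against `V₀ V₀†`, so it annihilates the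
  -- range of `V₀`; positive matrices span everything.
  have hker : ∀ A : Matrix (Fin s) (Fin s) ℂ, T (V * A * Vᴴ) * V₀ = 0 ∧
      V₀ᴴ * T (V * A * Vᴴ) = 0 := by
    intro A
    have hA : A ∈ Submodule.span ℂ {A : Matrix (Fin s) (Fin s) ℂ | A.PosSemidef} := by
      rw [span_posSemidef_eq_top]; trivial
    induction hA using Submodule.span_induction with
    | mem A hA =>
      have hpos := h.positive _ (hA.mul_mul_conjTranspose_same V)
      have h1 : V₀ᴴ * T (V * A * Vᴴ) * V₀ = 0 := by
        rw [← (hpos.conjTranspose_mul_mul_same V₀).trace_eq_zero_iff, Matrix.mul_assoc,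
          Matrix.trace_mul_comm, Matrix.mul_assoc, Matrix.trace_mul_comm, ← h.dual]
        have h2 : (E (V₀ * V₀ᴴ) * (V * A * Vᴴ)).trace = (Vᴴ * E (V₀ * V₀ᴴ) * V * A).trace := by
          rw [Matrix.mul_assoc Vᴴ, Matrix.mul_assoc Vᴴ, Matrix.trace_mul_comm Vᴴ]
          simp only [Matrix.mul_assoc]
        rw [h2, hF, Matrix.zero_mul, Matrix.trace_zero]
      obtain ⟨C, hC⟩ := exists_eq_conjTranspose_mul_self hpos
      have h3 : C * V₀ = 0 := by
        apply Matrix.conjTranspose_mul_self_eq_zero.mp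
        rw [Matrix.conjTranspose_mul, ← h1, hC]
        simp only [Matrix.mul_assoc]
      have h4 : T (V * A * Vᴴ) * V₀ = 0 := by rw [hC, Matrix.mul_assoc, h3, Matrix.mul_zero]
      refine ⟨h4, ?_⟩
      have h5 := congrArg Matrix.conjTranspose h4
      rwa [Matrix.conjTranspose_mul, hpos.isHermitian.eq, Matrix.conjTranspose_zero] at h5
    | zero => simp
    | add A B _ _ hA hB =>
      simp only [Matrix.mul_add, Matrix.add_mul, map_add, hA.1, hA.2, hB.1, hB.2, add_zero, and_self]
    | smul c A _ hA =>
      simp only [Matrix.mul_smul, Matrix.smul_mul, map_smul, hA.1, hA.2, smul_zero, and_self]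
  have h1 : T (V * A * Vᴴ) = (V₀ * V₀ᴴ + V * Vᴴ) * T (V * A * Vᴴ) * (V₀ * V₀ᴴ + V * Vᴴ) := by
    rw [hsum, Matrix.one_mul, Matrix.mul_one]
  rw [h1, Matrix.add_mul, Matrix.mul_assoc V₀, (hker A).2, Matrix.mul_zero, zero_add,
    Matrix.mul_add, Matrix.mul_assoc _ (T _), ← Matrix.mul_assoc (T _) V₀, (hker A).1,
    Matrix.zero_mul, Matrix.mul_zero, zero_add, compression_apply]
  simp only [Matrix.mul_assoc]

/-- Peripheral eigenvectors dominated by `V D V†` live on the range of `V`. -/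
theorem eq_corner_of_dominated {r s : ℕ}
    {V₀ : Matrix ι (Fin r) ℂ} {V : Matrix ι (Fin s) ℂ} {D : Matrix (Fin s) (Fin s) ℂ}
    (hsum : V₀ * V₀ᴴ + V * Vᴴ = 1) (h0 : V₀ᴴ * V = 0) {Z : Matrix ι ι ℂ} {c c' : ℂ}
    (hZ : (c • (V * D * Vᴴ) - Zᴴ * Z).PosSemidef)
    (hZ' : (c' • (V * D * Vᴴ) - Zᴴᴴ * Zᴴ).PosSemidef) :
    Z = V * (Vᴴ * Z * V) * Vᴴ := by
  -- Compressing the domination to the range of `V₀` removes `V D V†` and leaves `-(Z V₀)†(Z V₀) ≥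
  -- 0`.
  have hkill : ∀ (c : ℂ) (Z : Matrix ι ι ℂ), (c • (V * D * Vᴴ) - Zᴴ * Z).PosSemidef →
      Z * V₀ = 0 := by
    intro c Z hZ
    have h1 := hZ.conjTranspose_mul_mul_same V₀
    have h2 : V₀ᴴ * (c • (V * D * Vᴴ) - Zᴴ * Z) * V₀ = -((Z * V₀)ᴴ * (Z * V₀)) := by
      have h3 : V₀ᴴ * (V * D * Vᴴ) = 0 := by
        rw [Matrix.mul_assoc, ← Matrix.mul_assoc, h0, Matrix.zero_mul]
      rw [Matrix.mul_sub, Matrix.mul_smul, h3, smul_zero, zero_sub, Matrix.conjTranspose_mul,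
        Matrix.neg_mul]
      simp only [Matrix.mul_assoc]
    rw [h2] at h1
    exact Matrix.conjTranspose_mul_self_eq_zero.mp
      (eq_zero_of_posSemidef_of_posSemidef_neg (Matrix.posSemidef_conjTranspose_mul_self _) h1)
  have hr := hkill c Z hZ
  have hl : V₀ᴴ * Z = 0 := by
    have := congrArg Matrix.conjTranspose (hkill c' Zᴴ hZ')
    rwa [Matrix.conjTranspose_mul, Matrix.conjTranspose_conjTranspose,
      Matrix.conjTranspose_zero] at this
  have h1 : Z = (V₀ * V₀ᴴ + V * Vᴴ) * Z * (V₀ * V₀ᴴ + V * Vᴴ) := by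
    rw [hsum, Matrix.one_mul, Matrix.mul_one]
  nth_rw 1 [h1]
  rw [Matrix.add_mul, Matrix.mul_assoc V₀, hl, Matrix.mul_zero, zero_add,
    Matrix.mul_add, Matrix.mul_assoc _ Z, ← Matrix.mul_assoc Z V₀, hr,
    Matrix.zero_mul, Matrix.mul_zero, zero_add]
  simp only [Matrix.mul_assoc]

theorem mem_peripheralSpan_iff_compression {V : Matrix ι κ ℂ}
    (hVT : ∀ A, T (V * A * Vᴴ) = V * compression V T A * Vᴴ)
    (hcorner : ∀ (Z : Matrix ι ι ℂ) (lam : ℂ), star lam * lam = 1 → T Z = lam • Z →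
      Z = V * (Vᴴ * Z * V) * Vᴴ) (X : Matrix ι ι ℂ) :
    X ∈ peripheralSpan T ↔ ∃ A ∈ peripheralSpan (compression V T), X = V * A * Vᴴ := by
  constructor
  · intro hX
    induction hX using Submodule.span_induction with
    | mem Z hZ =>
      obtain ⟨lam, hlam, hZ⟩ := hZ
      have h1 := hcorner Z lam hlam hZ
      refine ⟨Vᴴ * Z * V, Submodule.subset_span ⟨lam, hlam, ?_⟩, h1⟩
      rw [compression_apply, ← h1, hZ, Matrix.mul_smul, Matrix.smul_mul]
    | zero => exact ⟨0, Submodule.zero_mem _, by simp⟩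
    | add X Y _ _ hX hY =>
      obtain ⟨A, hA, rfl⟩ := hX
      obtain ⟨B, hB, rfl⟩ := hY
      exact ⟨A + B, Submodule.add_mem _ hA hB, by rw [Matrix.mul_add, Matrix.add_mul]⟩
    | smul c X _ hX =>
      obtain ⟨A, hA, rfl⟩ := hX
      exact ⟨c • A, Submodule.smul_mem _ _ hA, by rw [Matrix.mul_smul, Matrix.smul_mul]⟩
  · rintro ⟨A, hA, rfl⟩
    induction hA using Submodule.span_induction with
    | mem A hA =>
      obtain ⟨lam, hlam, hA⟩ := hA
      refine Submodule.subset_span ⟨lam, hlam, ?_⟩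
      rw [hVT, hA, Matrix.mul_smul, Matrix.smul_mul]
    | zero => simp
    | add A B _ _ hA hB =>
      rw [Matrix.mul_add, Matrix.add_mul]
      exact Submodule.add_mem _ hA hB
    | smul c A _ hA =>
      rw [Matrix.mul_smul, Matrix.smul_mul]
      exact Submodule.smul_mem _ _ hA

end Compression

/-! ### Assembly of the decomposition on the whole space. -/

theorem peripheralSpace_eq_peripheralSpan {d : ℕ}
    (T : Matrix (Fin d) (Fin d) ℂ →ₗ[ℂ] Matrix (Fin d) (Fin d) ℂ) :
    peripheralSpace T = peripheralSpan T := by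
  rw [peripheralSpace, peripheralSpan]
  congr 1
  ext X
  constructor
  · rintro ⟨φ, hφ⟩
    refine ⟨_, ?_, hφ⟩
    rw [Complex.star_def, Complex.conj_mul', mul_comm Complex.I, Complex.norm_exp_ofReal_mul_I]
    simp
  · rintro ⟨lam, hlam, hX⟩
    have h1 : ‖lam‖ = 1 := by
      rw [Complex.star_def, Complex.conj_mul'] at hlam
      have h2 : ‖lam‖ ^ 2 = 1 := by exact_mod_cast hlam
      exact (pow_eq_one_iff_of_nonneg (norm_nonneg _) two_ne_zero).mp h2
    refine ⟨lam.arg, ?_⟩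
    have h2 := Complex.norm_mul_exp_arg_mul_I lam
    rw [h1, Complex.ofReal_one, one_mul] at h2
    rw [hX, mul_comm, h2]

theorem fromCols_mul_blockTensor_mul {ι κ : Type*} [Fintype ι] [Fintype κ] {K r : ℕ}
    {n m : Fin K → ℕ} (V₀ : Matrix ι (Fin r) ℂ) (V : Matrix ι κ ℂ)
    (W : Matrix κ ((k : Fin K) × (Fin (n k) × Fin (m k))) ℂ)
    (x : (k : Fin K) → Matrix (Fin (n k)) (Fin (n k)) ℂ)
    (ρ : (k : Fin K) → Matrix (Fin (m k)) (Fin (m k)) ℂ) :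
    Matrix.fromCols V₀ (V * W) * blockTensor r x ρ * (Matrix.fromCols V₀ (V * W))ᴴ
      = V * blockEmbed W x ρ * Vᴴ := by
  rw [blockTensor, Matrix.conjTranspose_fromCols_eq_fromRows_conjTranspose,
    Matrix.fromCols_mul_fromBlocks, Matrix.fromCols_mul_fromRows, blockEmbed]
  simp only [Matrix.mul_zero, zero_add, Matrix.zero_mul, Matrix.conjTranspose_mul,
    Matrix.mul_assoc]

theorem theorem8 (d : ℕ) (T : Matrix (Fin d) (Fin d) ℂ →ₗ[ℂ] Matrix (Fin d) (Fin d) ℂ)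
    (hT : IsSchwarzMap T) :
    ∃ (K r : ℕ) (n m : Fin K → ℕ)
      (W : Matrix (Fin d) (BlockIndex r n m) ℂ)
      (ρ : (k : Fin K) → Matrix (Fin (m k)) (Fin (m k)) ℂ),
      (∀ k, 0 < n k) ∧ (∀ k, 0 < m k) ∧
      Wᴴ * W = 1 ∧ W * Wᴴ = 1 ∧
      (∀ k, (ρ k).PosDef ∧ (ρ k).trace = 1) ∧
      (∀ X : Matrix (Fin d) (Fin d) ℂ,
        X ∈ peripheralSpace T ↔
          ∃ x : (k : Fin K) → Matrix (Fin (n k)) (Fin (n k)) ℂ,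
            X = W * blockTensor r x ρ * Wᴴ) ∧
      ∃ (U : (k : Fin K) → Matrix.unitaryGroup (Fin (n k)) ℂ)
        (π : Equiv.Perm (Fin K)) (hπ : ∀ k, n (π k) = n k),
        ∀ x : (k : Fin K) → Matrix (Fin (n k)) (Fin (n k)) ℂ,
          T (W * blockTensor r x ρ * Wᴴ) =
            W * blockTensor r
              (fun k => (U k : Matrix (Fin (n k)) (Fin (n k)) ℂ) *
                Matrix.reindex (finCongr (hπ k)) (finCongr (hπ k)) (x (π k)) *
                (U k : Matrix (Fin (n k)) (Fin (n k)) ℂ)ᴴ) ρ * Wᴴ := by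
  have h : IsSchwarzPair T (dualMap T) :=
    ⟨trace_dualMap_mul T, hT.positive, hT.trace_preserving, hT.schwarz⟩
  obtain ⟨σ, hσ, hfix, hdom⟩ := h.isPositiveTracePreserving.exists_dominating_fixedPoint
  obtain ⟨r, s, V₀, V, D, hV₀, hV, hsum, hD, rfl⟩ := exists_support_isometry hσ
  -- Sandwiching the resolution of the identity between `V₀†` and `V` gives `V₀† V = V₀† V + V₀† V`.
  have h0 : V₀ᴴ * V = 0 := by
    have h1 := congrArg (fun M => V₀ᴴ * M * V) hsum
    have h2 : V₀ᴴ * (V₀ * V₀ᴴ + V * Vᴴ) * V = V₀ᴴ * V₀ * (V₀ᴴ * V) + V₀ᴴ * V * (Vᴴ * V) := by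
      simp only [Matrix.mul_add, Matrix.add_mul, Matrix.mul_assoc]
    simp only [h2, hV₀, hV, Matrix.one_mul, Matrix.mul_one] at h1
    simpa using h1
  have h0' : Vᴴ * V₀ = 0 := by
    have := congrArg Matrix.conjTranspose h0
    rwa [Matrix.conjTranspose_mul, Matrix.conjTranspose_conjTranspose,
      Matrix.conjTranspose_zero] at this
  have hVT := h.map_corner hsum h0 hD hfix
  have hcorner : ∀ (Z : Matrix (Fin d) (Fin d) ℂ) (lam : ℂ), star lam * lam = 1 →
      T Z = lam • Z → Z = V * (Vᴴ * Z * V) * Vᴴ := by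
    intro Z lam hlam hZ
    obtain ⟨c, hc⟩ := hdom Z lam hlam hZ
    -- `Z†` is also a peripheral eigenvector; its domination controls the range of `Z` as that of
    -- `Z` controls the kernel.
    obtain ⟨c', hc'⟩ := hdom Zᴴ (star lam) (by rwa [star_star, mul_comm]) (by
      rw [h.isPositiveTracePreserving.map_conjTranspose, hZ, Matrix.conjTranspose_smul])
    exact eq_corner_of_dominated hsum h0 hc hc'
  have hfix' : compression V T D = D := by
    have : Vᴴ * (V * D * Vᴴ) * V = (Vᴴ * V) * D * (Vᴴ * V) := by simp only [Matrix.mul_assoc]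
    rw [compression_apply, hfix, this, hV, Matrix.one_mul, Matrix.mul_one]
  obtain ⟨K, n, m, W, ρ, hn, hm, hW, hW', hρ, hX, U, π, hπ, hU⟩ :=
    (h.compress hV hVT).exists_structure hD hfix'
  -- The columns of `V₀` span `H₀`, the kernel of the fixed point; those of `V * W` are the frame of
  -- the corner carried into `ℂ^d`.
  refine ⟨K, r, n, m, Matrix.fromCols V₀ (V * W), ρ, hn, hm, ?_, ?_, hρ, fun X => ?_,
    U, π, hπ, fun x => ?_⟩
  · have h1 : Wᴴ * Vᴴ * (V * W) = Wᴴ * (Vᴴ * V) * W := by simp only [Matrix.mul_assoc]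
    rw [Matrix.conjTranspose_fromCols_eq_fromRows_conjTranspose, Matrix.fromRows_mul_fromCols,
      Matrix.conjTranspose_mul, h1, hV, Matrix.mul_one, hW, ← Matrix.mul_assoc, h0,
      Matrix.mul_assoc Wᴴ, h0', hV₀, Matrix.zero_mul, Matrix.mul_zero, Matrix.fromBlocks_one]
  · rw [Matrix.conjTranspose_fromCols_eq_fromRows_conjTranspose, Matrix.fromCols_mul_fromRows,
      Matrix.conjTranspose_mul, Matrix.mul_assoc V, ← Matrix.mul_assoc W, hW', Matrix.one_mul, hsum]
  · rw [peripheralSpace_eq_peripheralSpan, mem_peripheralSpan_iff_compression hVT hcorner]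
    simp only [fromCols_mul_blockTensor_mul, hX]
    constructor
    · rintro ⟨_, ⟨x, rfl⟩, rfl⟩
      exact ⟨x, rfl⟩
    · rintro ⟨x, rfl⟩
      exact ⟨_, ⟨x, rfl⟩, rfl⟩
  · rw [fromCols_mul_blockTensor_mul, fromCols_mul_blockTensor_mul, hVT, hU]
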